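/- Let $M$ be a smooth odd-dimensional manifold (Hausdorff, second countable), and let $\mathcal J=(F,\eta,\pi,\theta,\varphi)$ represent a generalized almost contact structure on $M$: $F$ is a vector field, $\eta$ a 1-form, $\pi$ a bivector field, $\theta$ a 2-form and $\varphi$ a $(1,1)$-tensor, all smooth, such that, with $(\pi^\sharp\alpha)(\beta)=\pi(\alpha,\beta)$ and $(\theta^\flat X)(Y)=\theta(X,Y)$, $$\theta^\flat\varphi=\varphi^*\theta^\flat,\quad \varphi\pi^\sharp=\pi^\sharp\varphi^*,\quad \varphi^2+\pi^\sharp\theta^\flat=-\mathrm{Id}+F\otimes\eta,\quad (\varphi^*)^2+\theta^\flat\pi^\sharp=-\mathrm{Id}+\eta\otimes F,$$ $$\eta\circ\varphi=0,\quad \eta\circ\pi^\sharp=0,\quad \pi^\sharp\eta=0,\quad \varphi(F)=0,\quad \iota_F\theta=0,\quad \eta(F)=1.$$ Let $\Phi(X+\alpha)=(\varphi X+\pi^\sharp\alpha)+(\theta^\flat X-\varphi^*\alpha)$ on $TM\oplus T^*M$, and put $$E^{(1,0)}=\{e-i\Phi(e)\mid e\in\ker\eta\oplus\ker F\},\qquad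 E^{(0,1)}=\{e+i\Phi(e)\mid e\in\ker\eta\oplus\ker F\},$$ where $\ker F\subset T^*M$ consists of the covectors vanishing on $F$. Let $L_F$ and $L_\eta$ be the complex line bundles spanned by $F$ and $\eta$, and let $L=L_F\oplus E^{(1,0)}$ and $L^*=L_\eta\oplus E^{(0,1)}$ in $(TM\oplus T^*M)_{\mathbb C}$. On $(TM\oplus T^*M)_{\mathbb C}$ consider the complex-linear extensions of the pairing $\langle X+\alpha,Y+\beta\rangle=\frac12(\beta(X)+\alpha(Y))$, of the Courant bracket $$[\![X+\alpha,Y+\beta]\!]=[X,Y]+\mathcal L_X\beta-\mathcal L_Y\alpha-\tfrac12 d(\iota_X\beta-\iota_Y\alpha)$$ and of the projection $\rho$ to the tangent bundle. Suppose that $\mathcal J$ is a generalized contact structure, i.e. that the space $\Gamma(L)$ of smooth sections of $L$ is closed under the Courant bracket. Then the following are equivalent. 1. The pair $(L,L^*)$ is a Lie bialgebroid: with the restrictions of $\rho$ and of the Courant bracket, both $L$ and $L^*$ are complex Lie algebroids (in particular $\Gamma(L^*)$ is closed under the Courant bracket), they are dual to each other through $\langle\cdot,\cdot\rangle$, and the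 Lie algebroid differential $d_{L^*}$ of $L^*$, acting on sections of $\wedge^\bullet L$, satisfies $d_{L^*}[\![X,Y]\!]=[d_{L^*}X,Y]+[X,d_{L^*}Y]$ for all $X,Y\in\Gamma(L)$, where $[\cdot,\cdot]$ is the Schouten bracket that extends the bracket of $\Gamma(L)$. 2. $d\eta$ is of type $(1,1)$ with respect to $\Phi$ on $(\ker\eta\oplus\ker F)_{\mathbb C}=E^{(1,0)}\oplus E^{(0,1)}$: $d\eta(\rho(u),\rho(v))=0$ whenever $u,v$ both lie in a fibre of $E^{(1,0)}$ or both lie in a fibre of $E^{(0,1)}$. -/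

import Mathlib

open scoped Manifold ContDiff

noncomputable section

namespace GenContact

/-! ### Complexification of a real vector space -/

/-- The complexification `V ⊗ ℂ` of a real vector space; the pair `(a, b)` stands for `a + i b`. -/
def Cplx (V : Type*) : Type _ := V × V

namespace Cplx

section Basic

variable {V W : Type*}

/-- The vector `a + i b`. -/
def mk (a b : V) : Cplx V := (a, b)

/-- Real part. -/
def re (v : Cplx V) : V := v.1

/-- Imaginary part. -/
def im (v : Cplx V) : V := v.2

@[simp] theorem re_mk (a b : V) : (mk a b).re = a := rfl
@[simp] theorem im_mk (a b : V) : (mk a b).im = b := rfl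

@[ext] theorem ext {v w : Cplx V} (h1 : v.re = w.re) (h2 : v.im = w.im) : v = w := Prod.ext h1 h2

variable [AddCommGroup V] [AddCommGroup W]

instance : AddCommGroup (Cplx V) := inferInstanceAs (AddCommGroup (V × V))

@[simp] theorem re_zero : (0 : Cplx V).re = 0 := rfl
@[simp] theorem im_zero : (0 : Cplx V).im = 0 := rfl
@[simp] theorem re_add (v w : Cplx V) : (v + w).re = v.re + w.re := rfl
@[simp] theorem im_add (v w : Cplx V) : (v + w).im = v.im + w.im := rfl
@[simp] theorem re_neg (v : Cplx V) : (-v).re = -v.re := rfl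
@[simp] theorem im_neg (v : Cplx V) : (-v).im = -v.im := rfl
@[simp] theorem re_sub (v w : Cplx V) : (v - w).re = v.re - w.re := rfl
@[simp] theorem im_sub (v w : Cplx V) : (v - w).im = v.im - w.im := rfl

/-- The inclusion of `V` into its complexification. -/
def ofReal (v : V) : Cplx V := mk v 0

@[simp] theorem re_ofReal (v : V) : (ofReal v).re = v := rfl
@[simp] theorem im_ofReal (v : V) : (ofReal v).im = 0 := rfl

variable [Module ℝ V] [Module ℝ W]

instance : SMul ℂ (Cplx V) :=
  ⟨fun c v => mk (c.re • v.re - c.im • v.im) (c.re • v.im + c.im • v.re)⟩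

@[simp] theorem re_smul (c : ℂ) (v : Cplx V) : (c • v).re = c.re • v.re - c.im • v.im := rfl
@[simp] theorem im_smul (c : ℂ) (v : Cplx V) : (c • v).im = c.re • v.im + c.im • v.re := rfl

instance : Module ℂ (Cplx V) where
  one_smul v := by ext <;> simp
  mul_smul c d v := by
    ext <;> simp only [re_smul, im_smul, Complex.mul_re, Complex.mul_im] <;> module
  smul_zero c := by ext <;> simp
  smul_add c v w := by ext <;> simp only [re_smul, im_smul, re_add, im_add] <;> module
  add_smul c d v := by
    ext <;> simp only [re_smul, im_smul, re_add, im_add, Complex.add_re, Complex.add_im] <;> module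
  zero_smul v := by ext <;> simp

/-- Complex-linear extension of a real-linear map. -/
def extend (f : V →ₗ[ℝ] W) : Cplx V →ₗ[ℂ] Cplx W where
  toFun v := mk (f v.re) (f v.im)
  map_add' v w := by ext <;> simp
  map_smul' c v := by ext <;> simp

/-- Complex-bilinear extension of a real-bilinear form. -/
def extendBilin (b : V →ₗ[ℝ] W →ₗ[ℝ] ℝ) : Cplx V →ₗ[ℂ] Cplx W →ₗ[ℂ] ℂ :=
  LinearMap.mk₂ ℂ
    (fun v w => ⟨b v.re w.re - b v.im w.im, b v.re w.im + b v.im w.re⟩)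
    (fun v v' w => by apply Complex.ext <;> simp <;> ring)
    (fun c v w => by apply Complex.ext <;> simp <;> ring)
    (fun v w w' => by apply Complex.ext <;> simp <;> ring)
    (fun c v w => by apply Complex.ext <;> simp <;> ring)

end Basic

end Cplx

/-! ### Tangent and cotangent spaces, the generalized tangent bundle -/

section Bundles

variable (E : Type*) [NormedAddCommGroup E] [NormedSpace ℝ E]
  {M : Type*} [TopologicalSpace M] [ChartedSpace E M]

/-- The tangent space of a manifold modelled on `E`. -/
abbrev Tan (x : M) : Type _ := TangentSpace 𝓘(ℝ, E) x

/-- The cotangent space. -/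
abbrev Cotan (x : M) : Type _ := TangentSpace 𝓘(ℝ, E) x →L[ℝ] ℝ

/-- The fibre of `TM ⊕ T*M`. -/
abbrev GenTan (x : M) : Type _ := Tan E x × Cotan E x

/-- The fibre of the complexified tangent bundle. -/
abbrev TanC (x : M) : Type _ := Cplx (Tan E x)

/-- The fibre of the complexification of `TM ⊕ T*M`. -/
abbrev GenTanC (x : M) : Type _ := Cplx (GenTan E x)

/-- The symmetric pairing `⟨X + α, Y + β⟩ = (β(X) + α(Y)) / 2`. -/
def pairing (x : M) : GenTan E x →ₗ[ℝ] GenTan E x →ₗ[ℝ] ℝ :=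
  LinearMap.mk₂ ℝ (fun u v => (1 / 2 : ℝ) * (v.2 u.1 + u.2 v.1))
    (fun u u' v => by simp; ring) (fun c u v => by simp; ring)
    (fun u v v' => by simp; ring) (fun c u v => by simp; ring)

/-- The complex-bilinear extension of the symmetric pairing. -/
def pairingC (x : M) : GenTanC E x →ₗ[ℂ] GenTanC E x →ₗ[ℂ] ℂ := Cplx.extendBilin (pairing E x)

/-- The anchor map, i.e. the projection of `(TM ⊕ T*M)_ℂ` to `TM_ℂ`. -/
def rho (x : M) : GenTanC E x →ₗ[ℂ] TanC E x := Cplx.extend (LinearMap.fst ℝ (Tan E x) (Cotan E x))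

end Bundles

/-! ### Calculus of vector fields and one-forms -/

section Calculus

variable {E : Type*} [NormedAddCommGroup E] [NormedSpace ℝ E]
  {M : Type*} [TopologicalSpace M] [ChartedSpace E M]

/-- The exterior derivative of a one-form, computed in the chart at `x`: if `a` is the expression
of `α` in that chart, then `dα(u, v) = (∂_u a)(v) - (∂_v a)(u)`. -/
def dForm (α : (x : M) → Cotan E x) (x : M) : Tan E x →L[ℝ] Tan E x →L[ℝ] ℝ :=
  let φ := extChartAt 𝓘(ℝ, E) x
  let a : E → E →L[ℝ] ℝ := fun y => (α (φ.symm y)).comp (mfderiv 𝓘(ℝ, E) 𝓘(ℝ, E) φ.symm y)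
  let D : E →L[ℝ] E →L[ℝ] ℝ := fderiv ℝ a (φ x)
  let A : Tan E x →L[ℝ] E := mfderiv 𝓘(ℝ, E) 𝓘(ℝ, E) φ x
  (ContinuousLinearMap.precomp ℝ A).comp ((D - D.flip).comp A)

/-- The Lie derivative of a one-form along a vector field, `ι_X dα + d(ι_X α)`. -/
def lieForm (X : (x : M) → Tan E x) (α : (x : M) → Cotan E x) (x : M) : Cotan E x :=
  dForm α x (X x) + mvfderiv 𝓘(ℝ, E) (fun y => α y (X y)) x

/-- The Courant bracket
`⟦X + α, Y + β⟧ = [X, Y] + L_X β - L_Y α - d(ι_X β - ι_Y α) / 2`. -/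
def courant (s t : (x : M) → GenTan E x) (x : M) : GenTan E x :=
  (VectorField.mlieBracket 𝓘(ℝ, E) (fun y => (s y).1) (fun y => (t y).1) x,
    lieForm (fun y => (s y).1) (fun y => (t y).2) x
      - lieForm (fun y => (t y).1) (fun y => (s y).2) x
      - (1 / 2 : ℝ) • mvfderiv 𝓘(ℝ, E) (fun y => (t y).2 (s y).1 - (s y).2 (t y).1) x)

/-- Complex-bilinear extension of the Courant bracket. -/
def courantC (s t : (x : M) → GenTanC E x) (x : M) : GenTanC E x :=
  Cplx.mk
    (courant (fun y => (s y).re) (fun y => (t y).re) x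
      - courant (fun y => (s y).im) (fun y => (t y).im) x)
    (courant (fun y => (s y).re) (fun y => (t y).im) x
      + courant (fun y => (s y).im) (fun y => (t y).re) x)

/-- Complex-bilinear extension of the Lie bracket of vector fields. -/
def lieC (Z W : (x : M) → TanC E x) (x : M) : TanC E x :=
  Cplx.mk
    (VectorField.mlieBracket 𝓘(ℝ, E) (fun y => (Z y).re) (fun y => (W y).re) x
      - VectorField.mlieBracket 𝓘(ℝ, E) (fun y => (Z y).im) (fun y => (W y).im) x)
    (VectorField.mlieBracket 𝓘(ℝ, E) (fun y => (Z y).re) (fun y => (W y).im) x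
      + VectorField.mlieBracket 𝓘(ℝ, E) (fun y => (Z y).im) (fun y => (W y).re) x)

/-- The derivative `Z f` of a complex function along a complex vector field. -/
def derC (Z : (x : M) → TanC E x) (f : M → ℂ) (x : M) : ℂ :=
  mvfderiv 𝓘(ℝ, E) f x (Z x).re + Complex.I * mvfderiv 𝓘(ℝ, E) f x (Z x).im

/-- Smooth complex-valued functions. -/
def SmoothFun (E : Type*) [NormedAddCommGroup E] [NormedSpace ℝ E]
    {M : Type*} [TopologicalSpace M] [ChartedSpace E M] (f : M → ℂ) : Prop :=
  ContMDiff 𝓘(ℝ, E) 𝓘(ℝ, ℂ) ∞ f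

variable [IsManifold 𝓘(ℝ, E) ∞ M]

/-- Smooth vector fields. -/
def SmoothVec (X : (x : M) → Tan E x) : Prop :=
  ContMDiff 𝓘(ℝ, E) (𝓘(ℝ, E).prod 𝓘(ℝ, E)) ∞ (fun x => (⟨x, X x⟩ : TangentBundle 𝓘(ℝ, E) M))

/-- Smooth one-forms, i.e. smooth sections of `Hom(TM, ℝ)`. -/
def SmoothForm (α : (x : M) → Cotan E x) : Prop :=
  ContMDiff 𝓘(ℝ, E) (𝓘(ℝ, E).prod 𝓘(ℝ, E →L[ℝ] ℝ)) ∞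
    (fun x => Bundle.TotalSpace.mk' (E →L[ℝ] ℝ)
      (E := fun x : M => Tan E x →L[ℝ] Bundle.Trivial M ℝ x) x (α x))

/-- Smooth complex vector fields. -/
def SmoothVecC (Z : (x : M) → TanC E x) : Prop :=
  SmoothVec (fun x => (Z x).re) ∧ SmoothVec (fun x => (Z x).im)

/-- Smooth sections of `TM ⊕ T*M`. -/
def SmoothGen (s : (x : M) → GenTan E x) : Prop :=
  SmoothVec (fun x => (s x).1) ∧ SmoothForm (fun x => (s x).2)

/-- Smooth sections of `(TM ⊕ T*M)_ℂ`. -/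
def SmoothGenC (s : (x : M) → GenTanC E x) : Prop :=
  SmoothGen (fun x => (s x).re) ∧ SmoothGen (fun x => (s x).im)

/-- `V` is a smooth complex vector subbundle of `(TM ⊕ T*M)_ℂ`: it is the image of a smooth
idempotent endomorphism of that bundle. -/
def IsSubbundle (V : (x : M) → Submodule ℂ (GenTanC E x)) : Prop :=
  ∃ P : (x : M) → GenTanC E x →ₗ[ℂ] GenTanC E x,
    (∀ x, P x ∘ₗ P x = P x ∧ LinearMap.range (P x) = V x) ∧
      ∀ s, SmoothGenC s → SmoothGenC (fun x => P x (s x))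

/-- The space `Γ(V)` of smooth sections of a subbundle `V` of `(TM ⊕ T*M)_ℂ`. -/
def sections (V : (x : M) → Submodule ℂ (GenTanC E x)) : Set ((x : M) → V x) :=
  {s | SmoothGenC (fun x => (s x : GenTanC E x))}

/-- `Γ(V)` is closed under the Courant bracket. -/
def IsCourantClosed (V : (x : M) → Submodule ℂ (GenTanC E x)) : Prop :=
  ∀ s ∈ sections V, ∀ t ∈ sections V,
    SmoothGenC (courantC (fun x => (s x : GenTanC E x)) (fun x => (t x : GenTanC E x))) ∧
      ∀ x, courantC (fun x => (s x : GenTanC E x)) (fun x => (t x : GenTanC E x)) x ∈ V x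

/-! ### Lie algebroids and Lie bialgebroids -/

/-- A complex Lie algebroid structure on a complex vector bundle over `M` with fibres `V x` and
space of smooth sections `Γ`. Only the restriction of `bracket` to `Γ` is relevant. -/
structure LieAlgebroid (E : Type*) [NormedAddCommGroup E] [NormedSpace ℝ E]
    {M : Type*} [TopologicalSpace M] [ChartedSpace E M] [IsManifold 𝓘(ℝ, E) ∞ M]
    {V : M → Type*} [∀ x, AddCommGroup (V x)] [∀ x, Module ℂ (V x)]
    (Γ : Set ((x : M) → V x)) where
  /-- the anchor map, a smooth bundle map -/
  anchor : (x : M) → V x →ₗ[ℂ] TanC E x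
  anchor_smooth : ∀ s ∈ Γ, SmoothVecC (fun x => anchor x (s x))
  /-- the bracket of sections -/
  bracket : ((x : M) → V x) → ((x : M) → V x) → (x : M) → V x
  bracket_mem : ∀ s ∈ Γ, ∀ t ∈ Γ, bracket s t ∈ Γ
  bracket_add : ∀ s ∈ Γ, ∀ t ∈ Γ, ∀ u ∈ Γ, bracket s (t + u) = bracket s t + bracket s u
  bracket_skew : ∀ s ∈ Γ, ∀ t ∈ Γ, bracket s t = -bracket t s
  jacobi : ∀ s ∈ Γ, ∀ t ∈ Γ, ∀ u ∈ Γ,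
    bracket (bracket s t) u + bracket (bracket t u) s + bracket (bracket u s) t = 0
  leibniz : ∀ s ∈ Γ, ∀ t ∈ Γ, ∀ f : M → ℂ, SmoothFun E f → ∀ x,
    bracket s (fun y => f y • t y) x
      = f x • bracket s t x + derC (fun y => anchor y (s y)) f x • t x
  anchor_bracket : ∀ s ∈ Γ, ∀ t ∈ Γ, ∀ x,
    anchor x (bracket s t x) = lieC (fun y => anchor y (s y)) (fun y => anchor y (t y)) x

section Bialgebroid

variable {A B : M → Type*} [∀ x, AddCommGroup (A x)] [∀ x, Module ℂ (A x)]
  [∀ x, AddCommGroup (B x)] [∀ x, Module ℂ (B x)]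
  {ΓA : Set ((x : M) → A x)} {ΓB : Set ((x : M) → B x)}

/-- `𝓛 X ξ` is the Lie derivative of the section `ξ` of `B = A*` along the section `X` of `A`:
`⟨Z, L_X ξ⟩ = ρ(X)⟨Z, ξ⟩ - ⟨[X, Z], ξ⟩` for all sections `Z` of `A`. -/
def IsLieDerivative (𝒜 : LieAlgebroid E ΓA) (ΓB : Set ((x : M) → B x))
    (pair : (x : M) → A x →ₗ[ℂ] B x →ₗ[ℂ] ℂ)
    (𝓛 : ((x : M) → A x) → ((x : M) → B x) → (x : M) → B x) : Prop :=
  ∀ X ∈ ΓA, ∀ ξ ∈ ΓB, 𝓛 X ξ ∈ ΓB ∧ ∀ Z ∈ ΓA, ∀ x,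
    pair x (Z x) (𝓛 X ξ x)
      = derC (fun y => 𝒜.anchor y (X y)) (fun y => pair y (Z y) (ξ y)) x
        - pair x (𝒜.bracket X Z x) (ξ x)

/-- The Lie algebroid differential of `B = A*` on a section `Y` of `A = B*`; the result is a
section of `∧² A`, regarded as a 2-form on `B`. -/
def dualDifferential (ℬ : LieAlgebroid E ΓB) (pair : (x : M) → A x →ₗ[ℂ] B x →ₗ[ℂ] ℂ)
    (Y : (x : M) → A x) (ξ ζ : (x : M) → B x) (x : M) : ℂ :=
  derC (fun y => ℬ.anchor y (ξ y)) (fun y => pair y (Y y) (ζ y)) x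
    - derC (fun y => ℬ.anchor y (ζ y)) (fun y => pair y (Y y) (ξ y)) x
    - pair x (Y x) (ℬ.bracket ξ ζ x)

/-- The Lie derivative (Schouten bracket) `L_X P = [X, P]` of a section `P` of `∧² A`, regarded as
a 2-form on `B = A*`. -/
def lieTwo (𝒜 : LieAlgebroid E ΓA)
    (𝓛 : ((x : M) → A x) → ((x : M) → B x) → (x : M) → B x) (X : (x : M) → A x)
    (P : ((x : M) → B x) → ((x : M) → B x) → M → ℂ) (ξ ζ : (x : M) → B x) (x : M) : ℂ :=
  derC (fun y => 𝒜.anchor y (X y)) (P ξ ζ) x - P (𝓛 X ξ) ζ x - P ξ (𝓛 X ζ) x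

/-- Two Lie algebroids `A` and `B`, in duality through `pair`, form a Lie bialgebroid:
`d_B [X, Y] = [d_B X, Y] + [X, d_B Y] = L_X (d_B Y) - L_Y (d_B X)` for all sections `X, Y` of `A`.
The Lie derivative `𝓛` on sections of `B` is determined by `𝒜` and the pairing. -/
structure IsLieBialgebroid (𝒜 : LieAlgebroid E ΓA) (ℬ : LieAlgebroid E ΓB)
    (pair : (x : M) → A x →ₗ[ℂ] B x →ₗ[ℂ] ℂ) : Prop where
  perfect : ∀ x, (pair x).IsPerfPair
  smooth : ∀ X ∈ ΓA, ∀ ξ ∈ ΓB, SmoothFun E (fun x => pair x (X x) (ξ x))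
  compatible : ∃ 𝓛 : ((x : M) → A x) → ((x : M) → B x) → (x : M) → B x,
    IsLieDerivative 𝒜 ΓB pair 𝓛 ∧
      ∀ X ∈ ΓA, ∀ Y ∈ ΓA, ∀ ξ ∈ ΓB, ∀ ζ ∈ ΓB, ∀ x,
        dualDifferential ℬ pair (𝒜.bracket X Y) ξ ζ x
          = lieTwo 𝒜 𝓛 X (dualDifferential ℬ pair Y) ξ ζ x
            - lieTwo 𝒜 𝓛 Y (dualDifferential ℬ pair X) ξ ζ x

end Bialgebroid

/-- `𝒜` is the Lie algebroid structure on the subbundle `V` of `(TM ⊕ T*M)_ℂ` given by the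
restrictions of the anchor map and of the Courant bracket. -/
def IsInduced {V : (x : M) → Submodule ℂ (GenTanC E x)} (𝒜 : LieAlgebroid E (sections V)) : Prop :=
  (∀ x (v : V x), 𝒜.anchor x v = rho E x v) ∧
    ∀ s ∈ sections V, ∀ t ∈ sections V, ∀ x,
      (𝒜.bracket s t x : GenTanC E x)
        = courantC (fun y => (s y : GenTanC E y)) (fun y => (t y : GenTanC E y)) x

/-- The pair of subbundles `V`, `W` of `(TM ⊕ T*M)_ℂ`, with the anchor maps and brackets restricted
from `(TM ⊕ T*M)_ℂ` and in duality through the symmetric pairing, is a Lie bialgebroid. -/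
def FormLieBialgebroid (V W : (x : M) → Submodule ℂ (GenTanC E x)) : Prop :=
  IsSubbundle V ∧ IsSubbundle W ∧
    ∃ (𝒜 : LieAlgebroid E (sections V)) (ℬ : LieAlgebroid E (sections W)),
      IsInduced 𝒜 ∧ IsInduced ℬ ∧
        IsLieBialgebroid 𝒜 ℬ (fun x => (pairingC E x).domRestrict₁₂ (V x) (W x))

end Calculus

/-! ### Generalized contact structures -/

section Contact

/-- Tensors `(F, η, π, θ, φ)` representing a generalized almost contact structure. The bivector
field `π` is given as the bundle map `π♯ : T*M → TM`, `π(α, β) = β(π♯ α)`, and the two-form `θ` as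
the bundle map `θ♭ : TM → T*M`, `θ(X, Y) = (θ♭ X)(Y)`; `φ* α = α ∘ φ`. -/
structure AlmostContact (E : Type*) [NormedAddCommGroup E] [NormedSpace ℝ E]
    (M : Type*) [TopologicalSpace M] [ChartedSpace E M] [IsManifold 𝓘(ℝ, E) ∞ M] where
  F : (x : M) → Tan E x
  η : (x : M) → Cotan E x
  π : (x : M) → Cotan E x →L[ℝ] Tan E x
  θ : (x : M) → Tan E x →L[ℝ] Cotan E x
  φ : (x : M) → Tan E x →L[ℝ] Tan E x
  smooth_F : SmoothVec F
  smooth_η : SmoothForm η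
  smooth_π : ContMDiff 𝓘(ℝ, E) (𝓘(ℝ, E).prod 𝓘(ℝ, (E →L[ℝ] ℝ) →L[ℝ] E)) ∞
    (fun x => Bundle.TotalSpace.mk' ((E →L[ℝ] ℝ) →L[ℝ] E)
      (E := fun x : M => (Tan E x →L[ℝ] Bundle.Trivial M ℝ x) →L[ℝ] Tan E x) x (π x))
  smooth_θ : ContMDiff 𝓘(ℝ, E) (𝓘(ℝ, E).prod 𝓘(ℝ, E →L[ℝ] E →L[ℝ] ℝ)) ∞
    (fun x => Bundle.TotalSpace.mk' (E →L[ℝ] E →L[ℝ] ℝ)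
      (E := fun x : M => Tan E x →L[ℝ] Tan E x →L[ℝ] Bundle.Trivial M ℝ x) x (θ x))
  smooth_φ : ContMDiff 𝓘(ℝ, E) (𝓘(ℝ, E).prod 𝓘(ℝ, E →L[ℝ] E)) ∞
    (fun x => Bundle.TotalSpace.mk' (E →L[ℝ] E)
      (E := fun x : M => Tan E x →L[ℝ] Tan E x) x (φ x))
  skew_π : ∀ x (α β : Cotan E x), β (π x α) = -α (π x β)
  skew_θ : ∀ x (X Y : Tan E x), θ x X Y = -θ x Y X
  θ_φ : ∀ x (X : Tan E x), θ x (φ x X) = (θ x X).comp (φ x)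
  φ_π : ∀ x (α : Cotan E x), φ x (π x α) = π x (α.comp (φ x))
  φ_sq : ∀ x (X : Tan E x), φ x (φ x X) + π x (θ x X) = -X + η x X • F x
  φ_star_sq : ∀ x (α : Cotan E x),
    (α.comp (φ x)).comp (φ x) + θ x (π x α) = -α + α (F x) • η x
  η_φ : ∀ x, (η x).comp (φ x) = 0
  η_π : ∀ x (α : Cotan E x), η x (π x α) = 0
  π_η : ∀ x, π x (η x) = 0
  φ_F : ∀ x, φ x (F x) = 0
  θ_F : ∀ x, θ x (F x) = 0
  η_F : ∀ x, η x (F x) = 1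

namespace AlmostContact

variable {E : Type*} [NormedAddCommGroup E] [NormedSpace ℝ E]
  {M : Type*} [TopologicalSpace M] [ChartedSpace E M] [IsManifold 𝓘(ℝ, E) ∞ M]
  (J : AlmostContact E M)

/-- The endomorphism `Φ(X + α) = (φ X + π♯ α) + (θ♭ X - φ* α)` of `TM ⊕ T*M`. -/
def Phi (x : M) : GenTan E x →ₗ[ℝ] GenTan E x where
  toFun e := (J.φ x e.1 + J.π x e.2, J.θ x e.1 - e.2.comp (J.φ x))
  map_add' e f := by
    ext1
    · simp only [Prod.fst_add, Prod.snd_add, map_add]; abel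
    · ext v; simp; ring
  map_smul' c e := by
    ext1
    · simp
    · ext v; simp; ring

/-- The fibre of the real bundle `ker η ⊕ ker F`. -/
def kerBundle (x : M) : Submodule ℝ (GenTan E x) where
  carrier := {e | J.η x e.1 = 0 ∧ e.2 (J.F x) = 0}
  zero_mem' := by simp
  add_mem' := by
    rintro a b ⟨h1, h2⟩ ⟨h3, h4⟩
    exact ⟨by simp [h1, h3], by simp [h2, h4]⟩
  smul_mem' := by
    rintro c a ⟨h1, h2⟩
    exact ⟨by simp [h1], by simp [h2]⟩

theorem Phi_mem_kerBundle (x : M) (e : GenTan E x) :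
    J.Phi x e ∈ J.kerBundle x := by
  have h1 : J.η x (J.φ x e.1) = 0 := congrArg (fun f => f e.1) (J.η_φ x)
  have h2 : J.θ x e.1 (J.F x) = 0 := by rw [J.skew_θ, J.θ_F]; simp
  exact ⟨by simp [Phi, h1, J.η_π], by simp [Phi, h2, J.φ_F]⟩

theorem Phi_Phi (x : M) {e : GenTan E x} (he : e ∈ J.kerBundle x) :
    J.Phi x (J.Phi x e) = -e := by
  obtain ⟨h1, h2⟩ := he
  have a1 := J.φ_sq x e.1
  have a2 := J.φ_star_sq x e.2
  rw [h1, zero_smul, add_zero] at a1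
  rw [h2, zero_smul, add_zero] at a2
  have b1 := J.φ_π x e.2
  have b2 := J.θ_φ x e.1
  apply Prod.ext
  · change J.φ x (J.φ x e.1 + J.π x e.2) + J.π x (J.θ x e.1 - e.2.comp (J.φ x)) = -e.1
    rw [map_add, map_sub, b1, ← a1]; abel
  · change J.θ x (J.φ x e.1 + J.π x e.2) - (J.θ x e.1 - e.2.comp (J.φ x)).comp (J.φ x) = -e.2
    rw [map_add, b2, ContinuousLinearMap.sub_comp, ← a2]; abel

/-- `E^{(1,0)} = {e - i Φ(e) | e ∈ ker η ⊕ ker F}`. -/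
def E10 (x : M) : Submodule ℂ (GenTanC E x) where
  carrier := {w | ∃ e ∈ J.kerBundle x,
    w = Cplx.ofReal e - Complex.I • Cplx.ofReal (J.Phi x e)}
  zero_mem' := ⟨0, zero_mem _, by ext1 <;> simp⟩
  add_mem' := by
    rintro _ _ ⟨e, he, rfl⟩ ⟨f, hf, rfl⟩
    exact ⟨e + f, add_mem he hf, by ext1 <;> simp [add_comm]⟩
  smul_mem' := by
    rintro c _ ⟨e, he, rfl⟩
    refine ⟨c.re • e + c.im • J.Phi x e,
      add_mem (Submodule.smul_mem _ _ he) (Submodule.smul_mem _ _ (J.Phi_mem_kerBundle x e)), ?_⟩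
    ext1
    · simp
    · simp [J.Phi_Phi x he, add_comm]

/-- `E^{(0,1)} = {e + i Φ(e) | e ∈ ker η ⊕ ker F}`. -/
def E01 (x : M) : Submodule ℂ (GenTanC E x) where
  carrier := {w | ∃ e ∈ J.kerBundle x,
    w = Cplx.ofReal e + Complex.I • Cplx.ofReal (J.Phi x e)}
  zero_mem' := ⟨0, zero_mem _, by ext1 <;> simp⟩
  add_mem' := by
    rintro _ _ ⟨e, he, rfl⟩ ⟨f, hf, rfl⟩
    exact ⟨e + f, add_mem he hf, by ext1 <;> simp⟩
  smul_mem' := by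
    rintro c _ ⟨e, he, rfl⟩
    refine ⟨c.re • e - c.im • J.Phi x e,
      sub_mem (Submodule.smul_mem _ _ he) (Submodule.smul_mem _ _ (J.Phi_mem_kerBundle x e)), ?_⟩
    ext1
    · simp [sub_eq_add_neg]
    · simp [J.Phi_Phi x he, add_comm]

/-- `L_F`, the complex line bundle spanned by `F`. -/
def LF (x : M) : Submodule ℂ (GenTanC E x) :=
  Submodule.span ℂ {Cplx.ofReal ((J.F x, 0) : GenTan E x)}

/-- `L_η`, the complex line bundle spanned by `η`. -/
def Leta (x : M) : Submodule ℂ (GenTanC E x) :=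
  Submodule.span ℂ {Cplx.ofReal ((0, J.η x) : GenTan E x)}

/-- `L = L_F ⊕ E^{(1,0)}`. -/
def L (x : M) : Submodule ℂ (GenTanC E x) := J.LF x ⊔ J.E10 x

/-- `L* = L_η ⊕ E^{(0,1)}`. -/
def Lstar (x : M) : Submodule ℂ (GenTanC E x) := J.Leta x ⊔ J.E01 x

/-- The structure is a generalized contact structure: `Γ(L)` is closed under the Courant bracket. -/
def IsGeneralizedContact : Prop := IsCourantClosed J.L

/-- The pull-back `ρ* dη` of `dη` to `(TM ⊕ T*M)_ℂ`, as a complex-bilinear form. -/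
def pullbackDEta (x : M) : GenTanC E x →ₗ[ℂ] GenTanC E x →ₗ[ℂ] ℂ :=
  (Cplx.extendBilin (dForm J.η x).toLinearMap₁₂).compl₁₂ (rho E x) (rho E x)

/-- `dη` is of type `(1,1)` with respect to `Φ` on
`(ker η ⊕ ker F)_ℂ = E^{(1,0)} ⊕ E^{(0,1)}`: its pull-back vanishes whenever both arguments are in
`E^{(1,0)}` and whenever both arguments are in `E^{(0,1)}`. -/
def IsTypeOneOne : Prop :=
  ∀ x, (∀ u ∈ J.E10 x, ∀ v ∈ J.E10 x, J.pullbackDEta x u v = 0) ∧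
    ∀ u ∈ J.E01 x, ∀ v ∈ J.E01 x, J.pullbackDEta x u v = 0

end AlmostContact

end Contact

end GenContact

end

/-!
For sections of `TM ⊕ T*M` consider the Dorfman bracket
`(X + α) ∘ (Y + β) = [X, Y] + L_X β - ι_Y dα`. It satisfies
`s ∘ (t ∘ u) = (s ∘ t) ∘ u + t ∘ (s ∘ u)` (`dorfmanC_dorfmanC`), leaves the pairing invariant,
`ρ(s)⟨t, u⟩ = ⟨s ∘ t, u⟩ + ⟨t, s ∘ u⟩` (`derC_pairingC`), is skew up to a
differential, `⟨s ∘ t + t ∘ s, u⟩ = ρ(u)⟨s, t⟩` (`pairingC_dorfmanC_add`), and agrees with the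
Courant bracket on orthogonal sections (`courantC_eq_dorfmanC`). All of this follows from Cartan
calculus.

Suppose that `(TM ⊕ T*M)_ℂ = V ⊕ W` with `V` and `W` isotropic and involutive. Then both are Lie
algebroids, dual to each other through the pairing. The differential of `W` on a section `Y` of
`V` is `(ξ, ζ) ↦ -⟨Y ∘ ξ, ζ⟩`, and the Lie derivative of `ξ` along `X` is the `W`-component of
`X ∘ ξ`, so the compatibility condition is the Jacobi identity of the Dorfman bracket
(`IsSplitting.isLieBialgebroid`; this is the theorem of Liu, Weinstein and Xu).

As `Φ` is skew and squares to `-1` on `ker η ⊕ ker F`, the bundles `L` and `L*` form such a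
splitting (`AlmostContact.isSplitting`). Since `L` is involutive, `(L, L*)` is a Lie bialgebroid
if and only if `L*` is involutive. As `L*` is its own orthogonal complement, this means that
`T(s, t, u) = ⟨s ∘ t, u⟩` vanishes on `Γ(L*)`, where `T` is alternating and tensorial. On `E01` it
vanishes, because `E01` is conjugate to `E10 ⊆ L`. What remains is
`T(η, s, t) = -dη(ρ(s), ρ(t)) / 2` with `s`, `t` in `E01`, which vanishes exactly when
`dη` has no component of type `(0,2)`; as `dη` is real, then it has no component of type `(2,0)` either.
-/

noncomputable section

namespace GenContact

open Filter Topology Bundle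

/-! ### Vector fields and one-forms in a chart -/

section Chart

variable {E : Type*} [NormedAddCommGroup E] [NormedSpace ℝ E]
  {M : Type*} [TopologicalSpace M] [ChartedSpace E M]

/-- The expression of the vector field `X` in the chart at `x`, as a pull-back: with this form
`mlieBracket` unfolds to a bracket of vector fields on `E`. -/
def chartVec (x : M) (X : (x : M) → Tan E x) (y : E) : E :=
  (VectorField.mpullbackWithin 𝓘(ℝ, E) 𝓘(ℝ, E) (extChartAt 𝓘(ℝ, E) x).symm X
    (Set.range 𝓘(ℝ, E)) y : TangentSpace 𝓘(ℝ, E) y)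

/-- The expression of the one-form `α` in the chart at `x`. -/
def chartForm (x : M) (α : (x : M) → Cotan E x) (y : E) : E →L[ℝ] ℝ :=
  (α ((extChartAt 𝓘(ℝ, E) x).symm y)).comp
    (mfderiv 𝓘(ℝ, E) 𝓘(ℝ, E) (extChartAt 𝓘(ℝ, E) x).symm y)

theorem mvfderiv_eq_fderiv {V : Type*} [NormedAddCommGroup V] [NormedSpace ℝ V] {f : M → V} {x : M}
    (hf : MDifferentiableAt 𝓘(ℝ, E) 𝓘(ℝ, V) f x) (v : Tan E x) :
    mvfderiv 𝓘(ℝ, E) f x v =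
      fderiv ℝ (fun y => f ((extChartAt 𝓘(ℝ, E) x).symm y)) (extChartAt 𝓘(ℝ, E) x x) v := by
  simp only [mvfderiv, mfderiv, hf, ModelWithCorners.range_eq_univ, fderivWithin_univ]
  rfl

variable [IsManifold 𝓘(ℝ, E) ∞ M]

theorem chartForm_chartVec {x : M} {y : E} (hy : y ∈ (extChartAt 𝓘(ℝ, E) x).target)
    (α : (x : M) → Cotan E x) (X : (x : M) → Tan E x) :
    chartForm x α y (chartVec x X y) =
      α ((extChartAt 𝓘(ℝ, E) x).symm y) (X ((extChartAt 𝓘(ℝ, E) x).symm y)) := by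
  have h := isInvertible_mfderivWithin_extChartAt_symm (I := 𝓘(ℝ, E)) hy
  have e : mfderiv 𝓘(ℝ, E) 𝓘(ℝ, E) (extChartAt 𝓘(ℝ, E) x).symm y =
      mfderivWithin 𝓘(ℝ, E) 𝓘(ℝ, E) (extChartAt 𝓘(ℝ, E) x).symm (Set.range 𝓘(ℝ, E)) y := by
    rw [ModelWithCorners.range_eq_univ, mfderivWithin_univ]
  unfold chartForm chartVec
  rw [e]
  change α _ (mfderivWithin 𝓘(ℝ, E) 𝓘(ℝ, E) (extChartAt 𝓘(ℝ, E) x).symm (Set.range 𝓘(ℝ, E)) y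
    ((mfderivWithin 𝓘(ℝ, E) 𝓘(ℝ, E) (extChartAt 𝓘(ℝ, E) x).symm (Set.range 𝓘(ℝ, E)) y).inverse _))
    = _
  rw [h.self_apply_inverse]

theorem chartVec_self (x : M) (X : (x : M) → Tan E x) :
    chartVec x X (extChartAt 𝓘(ℝ, E) x x) = X x := by
  have h1 : (X ((extChartAt 𝓘(ℝ, E) x).symm (extChartAt 𝓘(ℝ, E) x x)) : E) = X x :=
    congrArg (fun z => (X z : E)) (extChartAt_to_inv x)
  refine Eq.trans ?_ (mfderivWithin_extChartAt_symm_inverse_apply (I := 𝓘(ℝ, E)) (X x))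
  exact congrArg (fun v : E => (mfderivWithin 𝓘(ℝ, E) 𝓘(ℝ, E) (extChartAt 𝓘(ℝ, E) x).symm
    (Set.range 𝓘(ℝ, E)) (extChartAt 𝓘(ℝ, E) x x)).inverse v) h1

/-- The differential of a chart at its own centre is the identity of `E = T_x M`, so no change of
coordinates is left. -/
theorem mlieBracket_eq (x : M) (X Y : (x : M) → Tan E x) :
    VectorField.mlieBracket 𝓘(ℝ, E) X Y x =
      VectorField.lieBracket ℝ (chartVec x X) (chartVec x Y) (extChartAt 𝓘(ℝ, E) x x) := by
  have h2 : (Set.univ : Set E) = (extChartAt 𝓘(ℝ, E) x).symm ⁻¹' Set.univ ∩ Set.range 𝓘(ℝ, E) := by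
    simp
  rw [← VectorField.lieBracketWithin_univ, h2, ← VectorField.mlieBracketWithin_univ,
    VectorField.mlieBracketWithin_apply, mfderiv_extChartAt_self]
  exact congr($(ContinuousLinearMap.inverse_id (R := ℝ) (M := E)) _)

theorem dForm_eq (α : (x : M) → Cotan E x) (x : M) (u v : Tan E x) :
    dForm α x u v = fderiv ℝ (chartForm x α) (extChartAt 𝓘(ℝ, E) x x) u v
      - fderiv ℝ (chartForm x α) (extChartAt 𝓘(ℝ, E) x x) v u := by
  have hA := mfderiv_extChartAt_self (I := 𝓘(ℝ, E)) (x := x)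
  have hu : (mfderiv 𝓘(ℝ, E) 𝓘(ℝ, E) (extChartAt 𝓘(ℝ, E) x) x u : E) = u := congr($hA u)
  have hv : (mfderiv 𝓘(ℝ, E) 𝓘(ℝ, E) (extChartAt 𝓘(ℝ, E) x) x v : E) = v := congr($hA v)
  change fderiv ℝ (chartForm x α) (extChartAt 𝓘(ℝ, E) x x)
      (mfderiv 𝓘(ℝ, E) 𝓘(ℝ, E) (extChartAt 𝓘(ℝ, E) x) x u : E)
      (mfderiv 𝓘(ℝ, E) 𝓘(ℝ, E) (extChartAt 𝓘(ℝ, E) x) x v : E)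
    - fderiv ℝ (chartForm x α) (extChartAt 𝓘(ℝ, E) x x)
      (mfderiv 𝓘(ℝ, E) 𝓘(ℝ, E) (extChartAt 𝓘(ℝ, E) x) x v : E)
      (mfderiv 𝓘(ℝ, E) 𝓘(ℝ, E) (extChartAt 𝓘(ℝ, E) x) x u : E) = _
  rw [hu, hv]

theorem mvfderiv_apply_eq {f : M → ℝ} {x : M} {y : E} (hy : y ∈ (extChartAt 𝓘(ℝ, E) x).target)
    (hf : MDifferentiable 𝓘(ℝ, E) 𝓘(ℝ, ℝ) f) (X : (x : M) → Tan E x) :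
    mvfderiv 𝓘(ℝ, E) f ((extChartAt 𝓘(ℝ, E) x).symm y) (X ((extChartAt 𝓘(ℝ, E) x).symm y)) =
      fderiv ℝ (fun z => f ((extChartAt 𝓘(ℝ, E) x).symm z)) y (chartVec x X y) := by
  have h0 := chartForm_chartVec hy (fun z => mvfderiv 𝓘(ℝ, E) f z) X
  rw [← h0]
  have hs : MDifferentiableAt 𝓘(ℝ, E) 𝓘(ℝ, E) (extChartAt 𝓘(ℝ, E) x).symm y := by
    have := mdifferentiableWithinAt_extChartAt_symm (I := 𝓘(ℝ, E)) hy
    rwa [ModelWithCorners.range_eq_univ, mdifferentiableWithinAt_univ] at this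
  have := mfderiv_comp y (hf _) hs
  have h3 : fderiv ℝ (fun z => f ((extChartAt 𝓘(ℝ, E) x).symm z)) y =
    mfderiv 𝓘(ℝ, E) 𝓘(ℝ, ℝ) (f ∘ (extChartAt 𝓘(ℝ, E) x).symm) y := by
    rw [mfderiv_eq_fderiv]; rfl
  rw [h3, this]
  rfl

/-- The trivialization of `T*M` at `x` is the one induced by the chart at `x`, so smoothness of `α`
as a section is smoothness of its chart expression near the centre. -/
theorem differentiableAt_chartForm {α : (x : M) → Cotan E x} (hα : SmoothForm α) (x : M) :
    DifferentiableAt ℝ (chartForm x α) (extChartAt 𝓘(ℝ, E) x x) := by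
  have h := (contMDiffAt_hom_bundle _).1 (hα x)
  have h2 := (h.2.mdifferentiableAt (by simp))
  have h3 := (mdifferentiableAt_iff _ _).1 h2
  have h4 := h3.2
  simp only [ModelWithCorners.range_eq_univ, differentiableWithinAt_univ] at h4
  refine h4.congr_of_eventuallyEq ?_
  filter_upwards [extChartAt_target_mem_nhds x] with y hy
  have hb : (extChartAt 𝓘(ℝ, E) x).symm y ∈ (chartAt E x).source := by
    rw [← extChartAt_source 𝓘(ℝ, E)]; exact (extChartAt 𝓘(ℝ, E) x).map_target hy
  ext v
  have hs := TangentBundle.symmL_trivializationAt (I := 𝓘(ℝ, E)) hb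
  rw [ModelWithCorners.range_eq_univ, mfderivWithin_univ,
    (extChartAt 𝓘(ℝ, E) x).right_inv hy] at hs
  refine (congrArg (fun w => α ((extChartAt 𝓘(ℝ, E) x).symm y) w) congr($hs v).symm).trans ?_
  simp [writtenInExtChartAt, ContinuousLinearMap.inCoordinates]
  rfl

theorem SmoothForm.apply {α : (x : M) → Cotan E x} (hα : SmoothForm α) {X : (x : M) → Tan E x}
    (hX : SmoothVec X) : ContMDiff 𝓘(ℝ, E) 𝓘(ℝ, ℝ) ∞ (fun x => α x (X x)) := by
  have := ContMDiff.clm_bundle_apply (b := fun x : M => x) (E₁ := fun x : M => Tan E x)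
    (E₂ := Bundle.Trivial M ℝ) (F₂ := ℝ) (F₁ := E) (ϕ := α) (v := X) hα hX
  intro x
  exact ((contMDiffAt_section _).1 (this x))

theorem SmoothVec.mvfderiv {f : M → ℝ} (hf : ContMDiff 𝓘(ℝ, E) 𝓘(ℝ, ℝ) ∞ f)
    {X : (x : M) → Tan E x} (hX : SmoothVec X) :
    ContMDiff 𝓘(ℝ, E) 𝓘(ℝ, ℝ) ∞ (fun y => mvfderiv 𝓘(ℝ, E) f y (X y)) := by
  have h := hf.contMDiff_tangentMap (m := ∞) (by simp)
  have h2 := h.comp hX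
  exact (contMDiff_snd_tangentBundle_modelSpace ℝ 𝓘(ℝ, ℝ)).comp h2

variable [CompleteSpace E]

theorem differentiableAt_chartVec {X : (x : M) → Tan E x} (hX : SmoothVec X) (x : M) :
    DifferentiableAt ℝ (chartVec x X) (extChartAt 𝓘(ℝ, E) x x) := by
  have h := ((hX x).mdifferentiableAt (by simp)).mdifferentiableWithinAt (s := Set.univ)
  have := h.differentiableWithinAt_mpullbackWithin_vectorField
  rw [Set.preimage_univ, Set.univ_inter, ModelWithCorners.range_eq_univ] at this
  rw [← differentiableWithinAt_univ]
  unfold chartVec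
  rw [ModelWithCorners.range_eq_univ]
  exact this

theorem mvfderiv_apply_eq_chart {α : (x : M) → Cotan E x} (hα : SmoothForm α)
    {X : (x : M) → Tan E x} (hX : SmoothVec X) (x : M) (u : Tan E x) :
    mvfderiv 𝓘(ℝ, E) (fun y => α y (X y)) x u =
      fderiv ℝ (chartForm x α) (extChartAt 𝓘(ℝ, E) x x) u (X x)
        + chartForm x α (extChartAt 𝓘(ℝ, E) x x)
          (fderiv ℝ (chartVec x X) (extChartAt 𝓘(ℝ, E) x x) u) := by
  rw [mvfderiv_eq_fderiv ((hα.apply hX x).mdifferentiableAt (by simp))]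
  have h1 : (fun y => α ((extChartAt 𝓘(ℝ, E) x).symm y) (X ((extChartAt 𝓘(ℝ, E) x).symm y)))
      =ᶠ[𝓝 (extChartAt 𝓘(ℝ, E) x x)] fun y => chartForm x α y (chartVec x X y) := by
    filter_upwards [extChartAt_target_mem_nhds x] with y hy using (chartForm_chartVec hy α X).symm
  rw [h1.fderiv_eq, fderiv_clm_apply (differentiableAt_chartForm hα x)
    (differentiableAt_chartVec hX x), chartVec_self]
  exact add_comm _ _

/-- The invariant formula `dα(X, Y) = X(α(Y)) - Y(α(X)) - α([X, Y])`. -/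
theorem dForm_apply {α : (x : M) → Cotan E x} (hα : SmoothForm α) {X Y : (x : M) → Tan E x}
    (hX : SmoothVec X) (hY : SmoothVec Y) (x : M) :
    dForm α x (X x) (Y x) = mvfderiv 𝓘(ℝ, E) (fun y => α y (Y y)) x (X x)
      - mvfderiv 𝓘(ℝ, E) (fun y => α y (X y)) x (Y x)
      - α x (VectorField.mlieBracket 𝓘(ℝ, E) X Y x) := by
  rw [dForm_eq, mvfderiv_apply_eq_chart hα hX, mvfderiv_apply_eq_chart hα hY]
  have h1 : chartForm x α (extChartAt 𝓘(ℝ, E) x x)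
      (VectorField.mlieBracket 𝓘(ℝ, E) X Y x : E) =
      α x (VectorField.mlieBracket 𝓘(ℝ, E) X Y x) := by
    have := chartForm_chartVec (mem_extChartAt_target (I := 𝓘(ℝ, E)) x) α
      (VectorField.mlieBracket 𝓘(ℝ, E) X Y)
    rwa [chartVec_self, extChartAt_to_inv] at this
  rw [← h1, mlieBracket_eq, VectorField.lieBracket, chartVec_self, chartVec_self, map_sub]
  ring

theorem mvfderiv_mlieBracket {f : M → ℝ} (hf : ContMDiff 𝓘(ℝ, E) 𝓘(ℝ, ℝ) ∞ f)
    {X Y : (x : M) → Tan E x} (hX : SmoothVec X) (hY : SmoothVec Y) (x : M) :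
    mvfderiv 𝓘(ℝ, E) f x (VectorField.mlieBracket 𝓘(ℝ, E) X Y x) =
      mvfderiv 𝓘(ℝ, E) (fun y => mvfderiv 𝓘(ℝ, E) f y (Y y)) x (X x)
      - mvfderiv 𝓘(ℝ, E) (fun y => mvfderiv 𝓘(ℝ, E) f y (X y)) x (Y x) := by
  have hd : MDifferentiable 𝓘(ℝ, E) 𝓘(ℝ, ℝ) f := hf.mdifferentiable (by simp)
  have hc : ContDiffAt ℝ 2 (fun y => f ((extChartAt 𝓘(ℝ, E) x).symm y))
      (extChartAt 𝓘(ℝ, E) x x) := by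
    have := (contMDiffAt_iff.1 (hf x)).2
    rw [ModelWithCorners.range_eq_univ, contDiffWithinAt_univ] at this
    exact this.of_le (by norm_cast)
  rw [mvfderiv_eq_fderiv (hd x), mlieBracket_eq,
    VectorField.fderiv_apply_lieBracket hc (by simp) (differentiableAt_chartVec hY x)
      (differentiableAt_chartVec hX x),
    mvfderiv_eq_fderiv ((hX.mvfderiv hf x).mdifferentiableAt (by simp)),
    mvfderiv_eq_fderiv ((hY.mvfderiv hf x).mdifferentiableAt (by simp)), chartVec_self,
    chartVec_self]
  congr 2 <;> apply Filter.EventuallyEq.fderiv_eq <;>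
    filter_upwards [extChartAt_target_mem_nhds x] with y hy using (mvfderiv_apply_eq hy hd _).symm

end Chart

/-! ### Smooth sections with a prescribed value -/

section Extension

variable {E : Type*} [NormedAddCommGroup E] [NormedSpace ℝ E] [FiniteDimensional ℝ E]
  {M : Type*} [TopologicalSpace M] [ChartedSpace E M]

theorem contMDiffAt_clm {G : Type*} [NormedAddCommGroup G] [NormedSpace ℝ G] {A : M → E →L[ℝ] G}
    {x : M} (h : ∀ c, ContMDiffAt 𝓘(ℝ, E) 𝓘(ℝ, G) ∞ (fun y => A y c) x) :
    ContMDiffAt 𝓘(ℝ, E) 𝓘(ℝ, E →L[ℝ] G) ∞ A x := by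
  let b := Module.finBasis ℝ E
  have hA : A = fun y => ∑ i, ContinuousLinearMap.smulRightL ℝ E G
      (LinearMap.toContinuousLinearMap (b.coord i)) (A y (b i)) := by
    funext y
    refine ContinuousLinearMap.coe_injective (b.ext fun j => ?_)
    simp [Finsupp.single_apply, Finset.sum_ite_eq, b.repr_self]
  rw [hA]
  exact ContMDiffAt.sum fun i _ => ContMDiffAt.comp x
    (ContinuousLinearMap.contMDiff _).contMDiffAt (h (b i))

variable [T2Space M] [IsManifold 𝓘(ℝ, E) ∞ M]

/-- A vector extends to a global smooth section. Near the base point the section is constant in a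
trivialization, which is what `smoothForm_of_apply` needs. -/
theorem exists_contMDiff_section_eventuallyEq (F : Type*) [NormedAddCommGroup F] [NormedSpace ℝ F]
    {V : M → Type*} [TopologicalSpace (TotalSpace F V)] [∀ x, AddCommGroup (V x)]
    [∀ x, Module ℝ (V x)] [∀ x, TopologicalSpace (V x)] [FiberBundle F V] [VectorBundle ℝ F V]
    [ContMDiffVectorBundle ∞ F V 𝓘(ℝ, E)] {x : M} (v : V x) :
    ∃ s : (x : M) → V x, ContMDiff 𝓘(ℝ, E) (𝓘(ℝ, E).prod 𝓘(ℝ, F)) ∞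
      (fun x => TotalSpace.mk' F x (s x)) ∧ ∀ᶠ y in 𝓝 x, s y = FiberBundle.extend F v y := by
  obtain ⟨u, hu, hs⟩ := FiberBundle.exists_contMDiffOn_extend (k := ∞) 𝓘(ℝ, E) F v
  obtain ⟨f, hf, -⟩ := (SmoothBumpFunction.nhds_basis_support (I := 𝓘(ℝ, E))
    (interior_mem_nhds.2 hu)).mem_iff.1 (interior_mem_nhds.2 hu)
  refine ⟨(f : M → ℝ) • FiberBundle.extend F v, ContMDiffOn.smul_section_of_tsupport
    f.contMDiff.contMDiffOn isOpen_interior hf (hs.mono interior_subset), ?_⟩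
  filter_upwards [f.eventuallyEq_one] with y hy
  simp [hy]

theorem exists_smoothVec {x : M} (v : Tan E x) : ∃ X, SmoothVec X ∧ X x = v := by
  obtain ⟨s, hs, h⟩ := exists_contMDiff_section_eventuallyEq (E := E) E
    (V := fun x : M => Tan E x) v
  exact ⟨s, hs, by simpa using! h.self_of_nhds⟩

theorem exists_smoothForm {x : M} (a : Cotan E x) : ∃ α, SmoothForm α ∧ α x = a := by
  obtain ⟨s, hs, h⟩ := exists_contMDiff_section_eventuallyEq (E := E) (E →L[ℝ] ℝ)
    (V := fun x : M => Tan E x →L[ℝ] Bundle.Trivial M ℝ x) a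
  exact ⟨s, hs, by simpa using! h.self_of_nhds⟩

/-- A one-form is smooth as soon as its values on smooth vector fields are. -/
theorem smoothForm_of_apply {α : (x : M) → Cotan E x}
    (h : ∀ X, SmoothVec X → ContMDiff 𝓘(ℝ, E) 𝓘(ℝ, ℝ) ∞ (fun x => α x (X x))) :
    SmoothForm α := by
  intro x
  refine (contMDiffAt_hom_bundle _).2 ⟨contMDiffAt_id, contMDiffAt_clm fun c => ?_⟩
  obtain ⟨s, hs, h'⟩ := exists_contMDiff_section_eventuallyEq (E := E) E (V := fun x : M => Tan E x)
    ((trivializationAt E (fun x : M => Tan E x) x).symm x c)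
  refine (h s hs x).congr_of_eventuallyEq ?_
  filter_upwards [h', (trivializationAt E (fun x : M => Tan E x) x).open_baseSet.mem_nhds
    (FiberBundle.mem_baseSet_trivializationAt' x)] with y hy hb
  rw [hy]
  have hx := FiberBundle.mem_baseSet_trivializationAt' (F := E) (E := fun x : M => Tan E x) x
  simp [ContinuousLinearMap.inCoordinates, FiberBundle.extend]
  rw [Trivialization.apply_mk_symm _ hx]
  exact congrArg (α y) (Trivialization.symmL_apply _ hb c)

end Extension

/-! ### Spaces of smooth sections and their Cartan calculus -/

section SmoothClosure

variable {E : Type*} [NormedAddCommGroup E] [NormedSpace ℝ E]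
  {M : Type*} [TopologicalSpace M] [ChartedSpace E M] [IsManifold 𝓘(ℝ, E) ∞ M]

theorem SmoothVec.add {X Y : (x : M) → Tan E x} (hX : SmoothVec X) (hY : SmoothVec Y) :
    SmoothVec (X + Y) := ContMDiff.add_section hX hY

theorem SmoothVec.fun_smul {f : M → ℝ} {X : (x : M) → Tan E x}
    (hf : ContMDiff 𝓘(ℝ, E) 𝓘(ℝ, ℝ) ∞ f) (hX : SmoothVec X) : SmoothVec (fun x => f x • X x) :=
  ContMDiff.smul_section hf hX

theorem SmoothForm.add {α β : (x : M) → Cotan E x} (hα : SmoothForm α) (hβ : SmoothForm β) :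
    SmoothForm (α + β) :=
  ContMDiff.add_section (V := fun x : M => Tan E x →L[ℝ] Bundle.Trivial M ℝ x) hα hβ

theorem SmoothForm.fun_smul {f : M → ℝ} {α : (x : M) → Cotan E x}
    (hf : ContMDiff 𝓘(ℝ, E) 𝓘(ℝ, ℝ) ∞ f) (hα : SmoothForm α) :
    SmoothForm (fun x => f x • α x) :=
  ContMDiff.smul_section (V := fun x : M => Tan E x →L[ℝ] Bundle.Trivial M ℝ x) hf hα

variable (E M)

/-- The space of smooth vector fields. -/
def VecField : Submodule ℝ ((x : M) → Tan E x) where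
  carrier := {X | SmoothVec X}
  add_mem' := SmoothVec.add
  zero_mem' := contMDiff_zeroSection ℝ (fun x : M => Tan E x)
  smul_mem' c _ hX := SmoothVec.fun_smul (f := fun _ => c) contMDiff_const hX

/-- The space of smooth one-forms. -/
def OneForm : Submodule ℝ ((x : M) → Cotan E x) where
  carrier := {α | SmoothForm α}
  add_mem' := SmoothForm.add
  zero_mem' := contMDiff_zeroSection ℝ (fun x : M => Tan E x →L[ℝ] Bundle.Trivial M ℝ x)
  smul_mem' c _ hα := SmoothForm.fun_smul (f := fun _ => c) contMDiff_const hα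

/-- The space of smooth real functions. -/
def RealFun : Submodule ℝ (M → ℝ) where
  carrier := {f | ContMDiff 𝓘(ℝ, E) 𝓘(ℝ, ℝ) ∞ f}
  add_mem' := ContMDiff.add
  zero_mem' := contMDiff_const
  smul_mem' c f hf := by
    have : ContMDiff 𝓘(ℝ, E) 𝓘(ℝ, ℝ) ∞ fun _ : M => c := contMDiff_const
    exact this.smul hf

end SmoothClosure

section Cartan

variable {E : Type*} [NormedAddCommGroup E] [NormedSpace ℝ E] [FiniteDimensional ℝ E]
  {M : Type*} [TopologicalSpace M] [ChartedSpace E M] [IsManifold 𝓘(ℝ, E) ∞ M]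

theorem SmoothVec.mlieBracket {X Y : (x : M) → Tan E x} (hX : SmoothVec X) (hY : SmoothVec Y) :
    SmoothVec (VectorField.mlieBracket 𝓘(ℝ, E) X Y) := by
  have := FiniteDimensional.complete ℝ E
  have : IsManifold 𝓘(ℝ, E) (((⊤ : ℕ∞) : WithTop ℕ∞) + 1) M := by simpa
  have : IsManifold 𝓘(ℝ, E) (minSmoothness ℝ 2) M := by
    rw [minSmoothness_of_isRCLikeNormedField]; infer_instance
  exact ContDiff.mlieBracket_vectorField (m := ⊤) (n := ⊤) hX hY (by simp)

/-- The derivative of a smooth function along a smooth vector field. -/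
def der : VecField E M →ₗ[ℝ] RealFun E M →ₗ[ℝ] RealFun E M :=
  LinearMap.mk₂ ℝ (fun X f => ⟨fun x => mvfderiv 𝓘(ℝ, E) f.1 x (X.1 x), X.2.mvfderiv f.2⟩)
    (fun X Y f => by ext x; exact map_add _ _ _)
    (fun c X f => by ext x; exact map_smul _ _ _)
    (fun X f g => by
      ext x
      exact congr($(mvfderiv_add (f.2.mdifferentiable (by simp) x)
        (g.2.mdifferentiable (by simp) x)) (X.1 x)))
    (fun c X f => by
      ext x
      have h := mvfderiv_smul (a := fun _ : M => c) mdifferentiableAt_const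
        (f.2.mdifferentiable (by simp) x)
      rw [mvfderiv_const] at h
      refine congr($h (X.1 x)).trans ?_
      simp)

/-- The evaluation of a one-form on a vector field. -/
def ev : OneForm E M →ₗ[ℝ] VecField E M →ₗ[ℝ] RealFun E M :=
  LinearMap.mk₂ ℝ (fun α X => ⟨fun x => α.1 x (X.1 x), α.2.apply X.2⟩)
    (fun _ _ _ => rfl) (fun _ _ _ => rfl)
    (fun α X Y => by ext x; exact map_add _ _ _)
    (fun c α X => by ext x; exact map_smul _ _ _)

/-- The Lie bracket of smooth vector fields. -/
def lie : VecField E M →ₗ[ℝ] VecField E M →ₗ[ℝ] VecField E M :=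
  haveI := FiniteDimensional.complete ℝ E
  have hd (X : VecField E M) (x : M) := (X.2 x).mdifferentiableAt (n := ∞) (by simp)
  LinearMap.mk₂ ℝ (fun X Y => ⟨VectorField.mlieBracket 𝓘(ℝ, E) X.1 Y.1, X.2.mlieBracket Y.2⟩)
    (fun X Y Z => by ext x; exact VectorField.mlieBracket_add_left (hd X x) (hd Y x))
    (fun c X Y => by ext x; exact VectorField.mlieBracket_const_smul_left (hd X x))
    (fun X Y Z => by ext x; exact VectorField.mlieBracket_add_right (hd Y x) (hd Z x))
    (fun c X Y => by ext x; exact VectorField.mlieBracket_const_smul_right (hd Y x))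

theorem lie_swap (X Y : VecField E M) : lie X Y = -lie Y X := by
  ext x; exact VectorField.mlieBracket_swap_apply

theorem lie_lie (X Y Z : VecField E M) : lie X (lie Y Z) = lie (lie X Y) Z + lie Y (lie X Z) := by
  have := FiniteDimensional.complete ℝ E
  have : IsManifold 𝓘(ℝ, E) (minSmoothness ℝ 3) M := by
    rw [minSmoothness_of_isRCLikeNormedField]; infer_instance
  have hd (X : VecField E M) (x : M) := (X.2 x).of_le (m := 2) (by norm_cast)
  ext x
  exact VectorField.leibniz_identity_mlieBracket_apply (by simpa using hd X x)
    (by simpa using hd Y x) (by simpa using hd Z x)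

theorem der_lie (X Y : VecField E M) (f : RealFun E M) :
    der (lie X Y) f = der X (der Y f) - der Y (der X f) := by
  have := FiniteDimensional.complete ℝ E
  ext x
  exact mvfderiv_mlieBracket f.2 X.2 Y.2 x

variable [T2Space M]

theorem smoothForm_mvfderiv {f : M → ℝ} (hf : ContMDiff 𝓘(ℝ, E) 𝓘(ℝ, ℝ) ∞ f) :
    SmoothForm (fun x : M => (mvfderiv 𝓘(ℝ, E) f x : Cotan E x)) :=
  smoothForm_of_apply fun _ hX => hX.mvfderiv hf

theorem SmoothForm.dForm {α : (x : M) → Cotan E x} (hα : SmoothForm α) {X : (x : M) → Tan E x}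
    (hX : SmoothVec X) : SmoothForm (fun x => dForm α x (X x)) := by
  have := FiniteDimensional.complete ℝ E
  refine smoothForm_of_apply fun Y hY => ?_
  simp only [dForm_apply hα hX hY]
  exact ((hX.mvfderiv (hα.apply hY)).sub (hY.mvfderiv (hα.apply hX))).sub
    (hα.apply (hX.mlieBracket hY))

/-- Vector fields separate one-forms, since every tangent vector extends to a vector field. -/
theorem oneForm_ext {α β : OneForm E M} (h : ∀ X, ev α X = ev β X) : α = β := by
  ext x v
  obtain ⟨X, hX, rfl⟩ := exists_smoothVec v
  exact congr(($(h ⟨X, hX⟩)).1 x)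

/-- The differential of a smooth function. -/
def grad : RealFun E M →ₗ[ℝ] OneForm E M where
  toFun f := ⟨fun x => mvfderiv 𝓘(ℝ, E) f.1 x, smoothForm_mvfderiv f.2⟩
  map_add' f g := oneForm_ext fun X => (der X).map_add f g
  map_smul' c f := oneForm_ext fun X => (der X).map_smul c f

theorem ev_grad (f : RealFun E M) (X : VecField E M) : ev (grad f) X = der X f := rfl

/-- The contraction of `X` into `dα`. -/
def contrD : OneForm E M →ₗ[ℝ] VecField E M →ₗ[ℝ] OneForm E M :=
  haveI := FiniteDimensional.complete ℝ E
  have h (α : OneForm E M) (X Y : VecField E M) :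
      ev (⟨fun x => dForm α.1 x (X.1 x), α.2.dForm X.2⟩ : OneForm E M) Y =
        der X (ev α Y) - der Y (ev α X) - ev α (lie X Y) := by
    ext x; exact dForm_apply α.2 X.2 Y.2 x
  LinearMap.mk₂ ℝ (fun α X => ⟨fun x => dForm α.1 x (X.1 x), α.2.dForm X.2⟩)
    (fun α β X => oneForm_ext fun Y => by
      simp only [h, map_add, LinearMap.add_apply]; abel)
    (fun c α X => oneForm_ext fun Y => by
      simp only [h, map_smul, LinearMap.smul_apply, smul_sub])
    (fun α X Y => oneForm_ext fun Z => by
      simp only [h, map_add, LinearMap.add_apply]; abel)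
    (fun c α X => oneForm_ext fun Y => by
      simp only [h, map_smul, LinearMap.smul_apply, smul_sub])

theorem ev_contrD (α : OneForm E M) (X Y : VecField E M) :
    ev (contrD α X) Y = der X (ev α Y) - der Y (ev α X) - ev α (lie X Y) := by
  have := FiniteDimensional.complete ℝ E
  ext x; exact dForm_apply α.2 X.2 Y.2 x

end Cartan

/-! ### The Dorfman bracket from the rules of Cartan calculus -/

section CartanCalculus

/-- The formal rules of Cartan calculus, for a space `V` of vector fields, a space `Ω` of one-forms
and a space `C` of functions. The identities of the Dorfman bracket follow from these rules alone;
multiplication of sections by functions plays no role in them. -/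
structure CartanCalculus (V Ω C : Type*) [AddCommGroup V] [Module ℝ V] [AddCommGroup Ω] [Module ℝ Ω]
    [AddCommGroup C] [Module ℝ C] where
  /-- the derivative of a function along a vector field -/
  der : V →ₗ[ℝ] C →ₗ[ℝ] C
  /-- the value of a one-form on a vector field -/
  ev : Ω →ₗ[ℝ] V →ₗ[ℝ] C
  /-- the differential of a function -/
  grad : C →ₗ[ℝ] Ω
  /-- the Lie bracket -/
  lie : V →ₗ[ℝ] V →ₗ[ℝ] V
  /-- the contraction `ι_X dα` -/
  contrD : Ω →ₗ[ℝ] V →ₗ[ℝ] Ω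
  form_ext : ∀ α β, (∀ X, ev α X = ev β X) → α = β
  lie_swap : ∀ X Y, lie X Y = -lie Y X
  lie_lie : ∀ X Y Z, lie X (lie Y Z) = lie (lie X Y) Z + lie Y (lie X Z)
  der_lie : ∀ X Y f, der (lie X Y) f = der X (der Y f) - der Y (der X f)
  ev_grad : ∀ f X, ev (grad f) X = der X f
  ev_contrD : ∀ α X Y, ev (contrD α X) Y = der X (ev α Y) - der Y (ev α X) - ev α (lie X Y)

namespace CartanCalculus

variable {V Ω C : Type*} [AddCommGroup V] [Module ℝ V] [AddCommGroup Ω] [Module ℝ Ω]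
    [AddCommGroup C] [Module ℝ C] (K : CartanCalculus V Ω C)

/-- The Dorfman bracket `(X + α) ∘ (Y + β) = [X, Y] + L_X β - ι_Y dα`. -/
def dorf : (V × Ω) →ₗ[ℝ] (V × Ω) →ₗ[ℝ] (V × Ω) :=
  LinearMap.mk₂ ℝ
    (fun s t => (K.lie s.1 t.1, K.contrD t.2 s.1 + K.grad (K.ev t.2 s.1) - K.contrD s.2 t.1))
    (fun s s' t => by
      ext1 <;> simp only [Prod.fst_add, Prod.snd_add, map_add, LinearMap.add_apply]; abel)
    (fun c s t => by
      ext1 <;> simp only [Prod.smul_fst, Prod.smul_snd, map_smul, LinearMap.smul_apply]; module)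
    (fun s t t' => by
      ext1 <;> simp only [Prod.fst_add, Prod.snd_add, map_add, LinearMap.add_apply]; abel)
    (fun c s t => by
      ext1 <;> simp only [Prod.smul_fst, Prod.smul_snd, map_smul, LinearMap.smul_apply]; module)

/-- The symmetric pairing `⟨X + α, Y + β⟩ = (β(X) + α(Y)) / 2`. -/
def pair : (V × Ω) →ₗ[ℝ] (V × Ω) →ₗ[ℝ] C :=
  LinearMap.mk₂ ℝ (fun s t => (1 / 2 : ℝ) • (K.ev t.2 s.1 + K.ev s.2 t.1))
    (fun s s' t => by simp only [Prod.fst_add, Prod.snd_add, map_add, LinearMap.add_apply]; module)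
    (fun c s t => by
      simp only [Prod.smul_fst, Prod.smul_snd, map_smul, LinearMap.smul_apply]; module)
    (fun s t t' => by simp only [Prod.fst_add, Prod.snd_add, map_add, LinearMap.add_apply]; module)
    (fun c s t => by
      simp only [Prod.smul_fst, Prod.smul_snd, map_smul, LinearMap.smul_apply]; module)

/-- The Leibniz form of the Jacobi identity of the Dorfman bracket. -/
theorem dorf_dorf (s t u : V × Ω) :
    K.dorf s (K.dorf t u) = K.dorf (K.dorf s t) u + K.dorf t (K.dorf s u) := by
  ext1
  · exact K.lie_lie _ _ _
  · refine K.form_ext _ _ fun W => ?_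
    have h1 := congrArg (K.ev u.2) (K.lie_lie s.1 t.1 W)
    have h2 := congrArg (K.ev t.2) (K.lie_lie s.1 u.1 W)
    have h3 := congrArg (K.ev s.2) (K.lie_lie t.1 u.1 W)
    have h4 := congrArg (K.der W) (congrArg (K.ev s.2) (K.lie_swap t.1 u.1))
    have h5 := congrArg (K.der W) (congrArg (K.ev u.2) (K.lie_swap s.1 t.1))
    have h6 := congrArg (K.der W) (congrArg (K.ev t.2) (K.lie_swap s.1 u.1))
    simp only [dorf, LinearMap.mk₂_apply, Prod.snd_add, LinearMap.add_apply, LinearMap.sub_apply,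
      K.ev_contrD, K.ev_grad, map_add, map_sub, map_neg, K.der_lie] at h1 h2 h3 h4 h5 h6 ⊢
    rw [h1, h2, h3, h4, h5, h6]
    abel

/-- The pairing is invariant: `ρ(s)⟨t, u⟩ = ⟨s ∘ t, u⟩ + ⟨t, s ∘ u⟩`. -/
theorem der_pair (s t u : V × Ω) :
    K.der s.1 (K.pair t u) = K.pair (K.dorf s t) u + K.pair t (K.dorf s u) := by
  simp only [dorf, pair, LinearMap.mk₂_apply, LinearMap.add_apply, LinearMap.sub_apply,
    K.ev_contrD, K.ev_grad, map_add, map_sub, map_smul]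
  rw [K.lie_swap u.1 t.1]
  simp only [map_neg]
  module

/-- The symmetric part of the Dorfman bracket: `s ∘ t + t ∘ s = 2 d⟨s, t⟩`, where
`2⟨df, u⟩ = ρ(u) f`. -/
theorem pair_dorf_add (s t u : V × Ω) :
    K.pair (K.dorf s t + K.dorf t s) u = K.der u.1 (K.pair s t) := by
  simp only [dorf, pair, LinearMap.mk₂_apply, LinearMap.add_apply, LinearMap.sub_apply,
    K.ev_contrD, K.ev_grad, map_add, map_sub, map_smul]
  rw [K.lie_swap t.1 s.1]
  simp only [map_neg]
  module

end CartanCalculus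

end CartanCalculus

/-! ### The complexified Dorfman bracket -/

namespace Cplx

variable {V W U : Type*} [AddCommGroup V] [Module ℝ V] [AddCommGroup W] [Module ℝ W]
  [AddCommGroup U] [Module ℝ U]

/-- The complex-bilinear extension of a real-bilinear map. -/
def extend₂ (b : V →ₗ[ℝ] W →ₗ[ℝ] U) (v : Cplx V) (w : Cplx W) : Cplx U :=
  mk (b v.re w.re - b v.im w.im) (b v.re w.im + b v.im w.re)

@[simp] theorem re_extend₂ (b : V →ₗ[ℝ] W →ₗ[ℝ] U) (v : Cplx V) (w : Cplx W) :
    (extend₂ b v w).re = b v.re w.re - b v.im w.im := rfl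

@[simp] theorem im_extend₂ (b : V →ₗ[ℝ] W →ₗ[ℝ] U) (v : Cplx V) (w : Cplx W) :
    (extend₂ b v w).im = b v.re w.im + b v.im w.re := rfl

end Cplx

namespace CartanCalculus

variable {V Ω C : Type*} [AddCommGroup V] [Module ℝ V] [AddCommGroup Ω] [Module ℝ Ω]
    [AddCommGroup C] [Module ℝ C] (K : CartanCalculus V Ω C)

theorem dorfC_dorfC (s t u : Cplx (V × Ω)) :
    Cplx.extend₂ K.dorf s (Cplx.extend₂ K.dorf t u) =
      Cplx.extend₂ K.dorf (Cplx.extend₂ K.dorf s t) u +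
        Cplx.extend₂ K.dorf t (Cplx.extend₂ K.dorf s u) := by
  have h (s t u : V × Ω) : K.dorf (K.dorf s t) u = K.dorf s (K.dorf t u) - K.dorf t (K.dorf s u) :=
    eq_sub_of_add_eq (K.dorf_dorf s t u).symm
  ext1 <;> simp only [Cplx.re_extend₂, Cplx.im_extend₂, Cplx.re_add, Cplx.im_add, map_add,
    map_sub, LinearMap.add_apply, LinearMap.sub_apply, h] <;> abel

theorem derC_pairC (s t u : Cplx (V × Ω)) :
    Cplx.extend₂ (K.der ∘ₗ LinearMap.fst ℝ V Ω) s (Cplx.extend₂ K.pair t u) =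
      Cplx.extend₂ K.pair (Cplx.extend₂ K.dorf s t) u +
        Cplx.extend₂ K.pair t (Cplx.extend₂ K.dorf s u) := by
  ext1 <;> simp only [Cplx.re_extend₂, Cplx.im_extend₂, Cplx.re_add, Cplx.im_add, map_add,
    map_sub, LinearMap.add_apply, LinearMap.sub_apply, LinearMap.comp_apply, LinearMap.fst_apply,
    K.der_pair] <;> abel

theorem pairC_dorfC_add (s t u : Cplx (V × Ω)) :
    Cplx.extend₂ K.pair (Cplx.extend₂ K.dorf s t) u +
        Cplx.extend₂ K.pair (Cplx.extend₂ K.dorf t s) u =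
      Cplx.extend₂ (K.der ∘ₗ LinearMap.fst ℝ V Ω) u (Cplx.extend₂ K.pair s t) := by
  have h := K.pair_dorf_add
  simp only [map_add, LinearMap.add_apply] at h
  ext1 <;> simp only [Cplx.re_extend₂, Cplx.im_extend₂, Cplx.re_add, Cplx.im_add, map_add,
    map_sub, LinearMap.add_apply, LinearMap.sub_apply, LinearMap.comp_apply, LinearMap.fst_apply,
    ← h] <;> abel

/-- The Courant bracket is `s ∘ t - d⟨s, t⟩`. -/
theorem courant_eq (s t : V × Ω) :
    (K.lie s.1 t.1, K.contrD t.2 s.1 + K.grad (K.ev t.2 s.1) - (K.contrD s.2 t.1 +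
      K.grad (K.ev s.2 t.1)) - (1 / 2 : ℝ) • K.grad (K.ev t.2 s.1 - K.ev s.2 t.1)) =
      K.dorf s t - (0, K.grad (K.pair s t)) := by
  ext1
  · simp [dorf]
  · simp only [dorf, pair, LinearMap.mk₂_apply, Prod.snd_sub, map_smul, map_sub, map_add]
    module

end CartanCalculus

/-! ### The Dorfman bracket of complex sections -/

section Bridge

variable {E : Type*} [NormedAddCommGroup E] [NormedSpace ℝ E]
  {M : Type*} [TopologicalSpace M] [ChartedSpace E M]

/-- The Dorfman bracket `(X + α) ∘ (Y + β) = [X, Y] + L_X β - ι_Y dα`. -/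
def dorfman (s t : (x : M) → GenTan E x) (x : M) : GenTan E x :=
  (VectorField.mlieBracket 𝓘(ℝ, E) (fun y => (s y).1) (fun y => (t y).1) x,
    lieForm (fun y => (s y).1) (fun y => (t y).2) x - dForm (fun y => (s y).2) x (t x).1)

/-- Complex-bilinear extension of the Dorfman bracket. -/
def dorfmanC (s t : (x : M) → GenTanC E x) (x : M) : GenTanC E x :=
  Cplx.mk
    (dorfman (fun y => (s y).re) (fun y => (t y).re) x
      - dorfman (fun y => (s y).im) (fun y => (t y).im) x)
    (dorfman (fun y => (s y).re) (fun y => (t y).im) x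
      + dorfman (fun y => (s y).im) (fun y => (t y).re) x)

/-- The complex-valued function with given real and imaginary parts. -/
def valFun (f : Cplx (RealFun E M)) (x : M) : ℂ := ⟨f.re.1 x, f.im.1 x⟩

theorem valFun_add (f g : Cplx (RealFun E M)) (x : M) :
    valFun (f + g) x = valFun f x + valFun g x :=
  rfl

theorem smoothFun_valFun (f : Cplx (RealFun E M)) : SmoothFun E (valFun f) :=
  Complex.equivRealProdCLM.symm.toContinuousLinearMap.contMDiff.comp (f.re.2.prodMk_space f.im.2)

theorem mvfderiv_valFun (f : Cplx (RealFun E M)) (x : M) (v : Tan E x) :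
    mvfderiv 𝓘(ℝ, E) (valFun f) x v =
      ⟨mvfderiv 𝓘(ℝ, E) f.re.1 x v, mvfderiv 𝓘(ℝ, E) f.im.1 x v⟩ := by
  have hf := (smoothFun_valFun f).mdifferentiable (by simp) x
  have h (L : ℂ →L[ℝ] ℝ) : mvfderiv 𝓘(ℝ, E) (fun y => L (valFun f y)) x v =
      L (mvfderiv 𝓘(ℝ, E) (valFun f) x v) := by
    have h1 := mfderiv_comp x (L.mdifferentiableAt (x := valFun f x)) hf
    rw [ContinuousLinearMap.mfderiv_eq] at h1
    exact congr($h1 v)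
  exact Complex.ext (h Complex.reCLM).symm (h Complex.imCLM).symm

theorem derC_mul {Z : (x : M) → TanC E x} {f g : M → ℂ} (hf : SmoothFun E f) (hg : SmoothFun E g)
    (x : M) : derC Z (fun y => f y * g y) x = f x * derC Z g x + derC Z f x * g x := by
  have h1 := (hf.mdifferentiable (by simp) x).hasMFDerivAt
  have h2 := (hg.mdifferentiable (by simp) x).hasMFDerivAt
  have h3 := (h1.mul h2).mfderiv
  have h (v : Tan E x) : mvfderiv 𝓘(ℝ, E) (fun y => f y * g y) x v =
      f x * mvfderiv 𝓘(ℝ, E) g x v + g x * mvfderiv 𝓘(ℝ, E) f x v := congr($h3 v)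
  simp only [derC, h]
  ring

theorem pairingC_comm {x : M} (v w : GenTanC E x) :
    pairingC E x v w = pairingC E x w v := by
  apply Complex.ext <;> simp [pairingC, Cplx.extendBilin, pairing] <;> ring

theorem pairingC_nondegenerate {x : M} {v : GenTanC E x}
    (h : ∀ w, pairingC E x v w = 0) : v = 0 := by
  have hE (a : E) (ha : ∀ f : E →L[ℝ] ℝ, f a = 0) : a = 0 :=
    SeparatingDual.eq_zero_of_forall_dual_eq_zero (R := ℝ) ha
  have h1 (β : Cotan E x) := h (Cplx.ofReal (0, β))
  have h2 (X : Tan E x) := h (Cplx.ofReal (X, 0))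
  simp [pairingC, Cplx.extendBilin, pairing, Complex.ext_iff] at h1 h2
  exact Cplx.ext (Prod.ext (hE _ fun f => (h1 f).1) (by ext X; exact (h2 X).1))
    (Prod.ext (hE _ fun f => (h1 f).2) (by ext X; exact (h2 X).2))

variable [IsManifold 𝓘(ℝ, E) ∞ M]

/-- A smooth section of `TM ⊕ T*M` as a pair of a vector field and a one-form. -/
def liftGen {s : (x : M) → GenTan E x} (hs : SmoothGen s) : VecField E M × OneForm E M :=
  (⟨_, hs.1⟩, ⟨_, hs.2⟩)

/-- A smooth section of `(TM ⊕ T*M)_ℂ` as an element of the complexification of the space of pairs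
of a vector field and a one-form. -/
def liftGenC {s : (x : M) → GenTanC E x} (hs : SmoothGenC s) :
    Cplx (VecField E M × OneForm E M) :=
  Cplx.mk (liftGen hs.1) (liftGen hs.2)

/-- The section of `TM ⊕ T*M` given by a vector field and a one-form. -/
def valGen (S : VecField E M × OneForm E M) (x : M) : GenTan E x := (S.1.1 x, S.2.1 x)

/-- The section of `(TM ⊕ T*M)_ℂ` given by complexified pairs of vector fields and one-forms. The
operations on smooth sections are transported along this map from the bilinear maps of `cartan`. -/
def valGenC (S : Cplx (VecField E M × OneForm E M)) (x : M) : GenTanC E x :=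
  Cplx.mk (valGen S.re x) (valGen S.im x)

theorem smoothGenC_valGenC (S : Cplx (VecField E M × OneForm E M)) : SmoothGenC (valGenC S) :=
  ⟨⟨S.re.1.2, S.re.2.2⟩, ⟨S.im.1.2, S.im.2.2⟩⟩

theorem SmoothGenC.exists_eq {s : (x : M) → GenTanC E x} (hs : SmoothGenC s) :
    ∃ S, s = valGenC S := ⟨liftGenC hs, rfl⟩

theorem SmoothGenC.add {s t : (x : M) → GenTanC E x} (hs : SmoothGenC s) (ht : SmoothGenC t) :
    SmoothGenC (fun x => s x + t x) := by
  obtain ⟨S, rfl⟩ := hs.exists_eq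
  obtain ⟨T, rfl⟩ := ht.exists_eq
  exact smoothGenC_valGenC (S + T)

theorem SmoothGenC.fun_smul {f : M → ℂ} {s : (x : M) → GenTanC E x} (hf : SmoothFun E f)
    (hs : SmoothGenC s) : SmoothGenC (fun x => f x • s x) := by
  have h1 : ContMDiff 𝓘(ℝ, E) 𝓘(ℝ, ℝ) ∞ (fun x => (f x).re) := Complex.reCLM.contMDiff.comp hf
  have h2 : ContMDiff 𝓘(ℝ, E) 𝓘(ℝ, ℝ) ∞ (fun x => (f x).im) := Complex.imCLM.contMDiff.comp hf
  have h2' := h2.neg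
  obtain ⟨⟨a, b⟩, c, d⟩ := hs
  refine ⟨⟨(congrArg SmoothVec ?_).mp ((a.fun_smul h1).add (c.fun_smul h2')),
    (congrArg SmoothForm ?_).mp ((b.fun_smul h1).add (d.fun_smul h2'))⟩,
    (congrArg SmoothVec ?_).mp ((c.fun_smul h1).add (a.fun_smul h2)),
    (congrArg SmoothForm ?_).mp ((d.fun_smul h1).add (b.fun_smul h2))⟩ <;> funext x
  · simp [sub_eq_add_neg]
  · simp [sub_eq_add_neg]
    exact neg_smul (f x).im (s x).im.2
  · simp
  · simp

variable [FiniteDimensional ℝ E] [T2Space M]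

variable (E M) in
/-- The Cartan calculus of a manifold. -/
def cartan : CartanCalculus (VecField E M) (OneForm E M) (RealFun E M) where
  der := der
  ev := ev
  grad := grad
  lie := lie
  contrD := contrD
  form_ext _ _ := oneForm_ext
  lie_swap := lie_swap
  lie_lie := lie_lie
  der_lie := der_lie
  ev_grad := ev_grad
  ev_contrD := ev_contrD

theorem dorfmanC_valGenC (S T : Cplx (VecField E M × OneForm E M)) :
    dorfmanC (valGenC S) (valGenC T) = valGenC (Cplx.extend₂ (cartan E M).dorf S T) := rfl

theorem pairingC_valGenC (S T : Cplx (VecField E M × OneForm E M)) (x : M) :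
    pairingC E x (valGenC S x) (valGenC T x) =
      valFun (Cplx.extend₂ (cartan E M).pair S T) x := rfl

theorem derC_valGenC (S : Cplx (VecField E M × OneForm E M)) (f : Cplx (RealFun E M)) (x : M) :
    derC (fun y => rho E y (valGenC S y)) (valFun f) x =
      valFun (Cplx.extend₂ ((cartan E M).der ∘ₗ LinearMap.fst ℝ _ _) S f) x := by
  simp only [derC, mvfderiv_valFun]
  apply Complex.ext
  · simp
    rfl
  · simp
    rfl

theorem courantC_valGenC (S T : Cplx (VecField E M × OneForm E M)) :
    courantC (valGenC S) (valGenC T) = dorfmanC (valGenC S) (valGenC T) -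
      valGenC (Cplx.mk (0, (cartan E M).grad (Cplx.extend₂ (cartan E M).pair S T).re)
        (0, (cartan E M).grad (Cplx.extend₂ (cartan E M).pair S T).im)) := by
  have h (S T : VecField E M × OneForm E M) : courant (valGen S) (valGen T) =
      valGen ((cartan E M).dorf S T - (0, (cartan E M).grad ((cartan E M).pair S T))) :=
    congrArg valGen ((cartan E M).courant_eq S T)
  funext x
  have h' (S T : VecField E M × OneForm E M) := congrFun (h S T) x
  have hs (S T : VecField E M × OneForm E M) : valGen (S - T) x = valGen S x - valGen T x := rfl
  have ha (S T : VecField E M × OneForm E M) : valGen (S + T) x = valGen S x + valGen T x := rfl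
  have hs0 (a b : OneForm E M) : ((0, a - b) : VecField E M × OneForm E M) = (0, a) - (0, b) := by
    simp
  have ha0 (a b : OneForm E M) : ((0, a + b) : VecField E M × OneForm E M) = (0, a) + (0, b) := by
    simp
  rw [dorfmanC_valGenC]
  change _ = valGenC _ x - valGenC _ x
  ext1
  · refine (congrArg₂ (· - ·) (h' S.re T.re) (h' S.im T.im)).trans ?_
    simp only [valGenC, Cplx.re_mk, Cplx.re_sub, Cplx.re_extend₂, map_sub, hs, hs0]
    abel
  · refine (congrArg₂ (· + ·) (h' S.re T.im) (h' S.im T.re)).trans ?_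
    simp only [valGenC, Cplx.im_mk, Cplx.im_sub, Cplx.im_extend₂, map_add, hs, ha, ha0]
    abel

/-- On orthogonal sections the Courant and Dorfman brackets agree. -/
theorem courantC_eq_dorfmanC {s t : (x : M) → GenTanC E x} (hs : SmoothGenC s) (ht : SmoothGenC t)
    (h : ∀ x, pairingC E x (s x) (t x) = 0) : courantC s t = dorfmanC s t := by
  obtain ⟨S, rfl⟩ := hs.exists_eq
  obtain ⟨T, rfl⟩ := ht.exists_eq
  have h0 : Cplx.extend₂ (cartan E M).pair S T = 0 := by
    ext x
    · exact congrArg Complex.re (h x)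
    · exact congrArg Complex.im (h x)
  rw [courantC_valGenC, h0, Cplx.re_zero, Cplx.im_zero, map_zero]
  exact sub_zero _

theorem SmoothGenC.dorfmanC {s t : (x : M) → GenTanC E x} (hs : SmoothGenC s) (ht : SmoothGenC t) :
    SmoothGenC (dorfmanC s t) := by
  obtain ⟨S, rfl⟩ := hs.exists_eq
  obtain ⟨T, rfl⟩ := ht.exists_eq
  exact smoothGenC_valGenC (Cplx.extend₂ (cartan E M).dorf S T)

theorem SmoothGenC.pairingC {s t : (x : M) → GenTanC E x} (hs : SmoothGenC s) (ht : SmoothGenC t) :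
    SmoothFun E (fun x => pairingC E x (s x) (t x)) := by
  obtain ⟨S, rfl⟩ := hs.exists_eq
  obtain ⟨T, rfl⟩ := ht.exists_eq
  exact smoothFun_valFun (Cplx.extend₂ (cartan E M).pair S T)

theorem dorfmanC_dorfmanC {s t u : (x : M) → GenTanC E x} (hs : SmoothGenC s) (ht : SmoothGenC t)
    (hu : SmoothGenC u) : GenContact.dorfmanC s (GenContact.dorfmanC t u) =
      GenContact.dorfmanC (GenContact.dorfmanC s t) u +
        GenContact.dorfmanC t (GenContact.dorfmanC s u) := by
  obtain ⟨S, rfl⟩ := hs.exists_eq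
  obtain ⟨T, rfl⟩ := ht.exists_eq
  obtain ⟨U, rfl⟩ := hu.exists_eq
  exact congrArg valGenC ((cartan E M).dorfC_dorfC S T U)

theorem derC_pairingC {s t u : (x : M) → GenTanC E x} (hs : SmoothGenC s) (ht : SmoothGenC t)
    (hu : SmoothGenC u) (x : M) :
    derC (fun y => rho E y (s y)) (fun y => GenContact.pairingC E y (t y) (u y)) x =
      GenContact.pairingC E x (GenContact.dorfmanC s t x) (u x) +
        GenContact.pairingC E x (t x) (GenContact.dorfmanC s u x) := by
  obtain ⟨S, rfl⟩ := hs.exists_eq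
  obtain ⟨T, rfl⟩ := ht.exists_eq
  obtain ⟨U, rfl⟩ := hu.exists_eq
  simp only [dorfmanC_valGenC, pairingC_valGenC, derC_valGenC, ← valFun_add]
  rw [← CartanCalculus.derC_pairC, ← derC_valGenC]

theorem pairingC_dorfmanC_add {s t u : (x : M) → GenTanC E x} (hs : SmoothGenC s)
    (ht : SmoothGenC t) (hu : SmoothGenC u) (x : M) :
    GenContact.pairingC E x (GenContact.dorfmanC s t x) (u x) +
      GenContact.pairingC E x (GenContact.dorfmanC t s x) (u x) =
    derC (fun y => rho E y (u y)) (fun y => GenContact.pairingC E y (s y) (t y)) x := by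
  obtain ⟨S, rfl⟩ := hs.exists_eq
  obtain ⟨T, rfl⟩ := ht.exists_eq
  obtain ⟨U, rfl⟩ := hu.exists_eq
  simp only [dorfmanC_valGenC, pairingC_valGenC, ← valFun_add]
  rw [CartanCalculus.pairC_dorfC_add, ← derC_valGenC]

theorem dorfmanC_add {s t u : (x : M) → GenTanC E x} (hs : SmoothGenC s) (ht : SmoothGenC t)
    (hu : SmoothGenC u) : GenContact.dorfmanC s (fun x => t x + u x) =
      fun x => GenContact.dorfmanC s t x + GenContact.dorfmanC s u x := by
  obtain ⟨S, rfl⟩ := hs.exists_eq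
  obtain ⟨T, rfl⟩ := ht.exists_eq
  obtain ⟨U, rfl⟩ := hu.exists_eq
  refine congrArg valGenC (a₁ := Cplx.extend₂ (cartan E M).dorf S (T + U))
    (a₂ := Cplx.extend₂ (cartan E M).dorf S T + Cplx.extend₂ (cartan E M).dorf S U) ?_
  ext1 <;> simp only [Cplx.re_extend₂, Cplx.im_extend₂, Cplx.re_add, Cplx.im_add, map_add] <;> abel

theorem exists_smoothGenC {x : M} (w : GenTanC E x) : ∃ s, SmoothGenC s ∧ s x = w := by
  obtain ⟨a, ha, h1⟩ := exists_smoothVec w.re.1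
  obtain ⟨b, hb, h2⟩ := exists_smoothForm w.re.2
  obtain ⟨c, hc, h3⟩ := exists_smoothVec w.im.1
  obtain ⟨d, hd, h4⟩ := exists_smoothForm w.im.2
  refine ⟨fun y => Cplx.mk (a y, b y) (c y, d y), ⟨⟨ha, hb⟩, hc, hd⟩, ?_⟩
  simp only [h1, h2, h3, h4]
  rfl

/-- The Leibniz rule of the Dorfman bracket, from invariance and nondegeneracy of the pairing. -/
theorem dorfmanC_fun_smul {s t : (x : M) → GenTanC E x} {f : M → ℂ} (hf : SmoothFun E f)
    (hs : SmoothGenC s) (ht : SmoothGenC t) (x : M) :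
    GenContact.dorfmanC s (fun y => f y • t y) x =
      f x • GenContact.dorfmanC s t x + derC (fun y => rho E y (s y)) f x • t x := by
  rw [← sub_eq_zero]
  refine pairingC_nondegenerate fun w => ?_
  obtain ⟨u, hu, rfl⟩ := exists_smoothGenC w
  have h1 := derC_pairingC hs (ht.fun_smul hf) hu x
  have h2 := derC_pairingC hs ht hu x
  have h3 := derC_mul (Z := fun y => rho E y (s y)) hf (ht.pairingC hu) x
  simp only [map_smul, LinearMap.smul_apply, smul_eq_mul, map_sub, map_add, LinearMap.sub_apply,
    LinearMap.add_apply] at h1 ⊢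
  linear_combination h3 - h1 + f x * h2

end Bridge

/-! ### Complementary isotropic subbundles -/

section Isotropic

variable {E : Type*} [NormedAddCommGroup E] [NormedSpace ℝ E]
  {M : Type*} [TopologicalSpace M] [ChartedSpace E M]

theorem derC_zero (Z : (x : M) → TanC E x) (x : M) : derC Z (fun _ => 0) x = 0 := by
  simp [derC, mvfderiv_const]

theorem derC_neg (Z : (x : M) → TanC E x) (f : M → ℂ) (x : M) :
    derC Z (fun y => -f y) x = -derC Z f x := by
  have h : mvfderiv 𝓘(ℝ, E) (fun y => -f y) x = -mvfderiv 𝓘(ℝ, E) f x := mvfderiv_neg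
  simp only [derC, h, neg_apply]
  ring

/-- The subbundle `V` is isotropic for the symmetric pairing. -/
def IsIsotropic (V : (x : M) → Submodule ℂ (GenTanC E x)) : Prop :=
  ∀ x, ∀ u ∈ V x, ∀ v ∈ V x, pairingC E x u v = 0

variable [IsManifold 𝓘(ℝ, E) ∞ M] {V W : (x : M) → Submodule ℂ (GenTanC E x)}

theorem IsInduced.anchor_eq {𝒜 : LieAlgebroid E (sections V)} (h𝒜 : IsInduced 𝒜)
    (s : (x : M) → V x) : (fun y => 𝒜.anchor y (s y)) = fun y => rho E y (s y) :=
  funext fun y => h𝒜.1 y (s y)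

/-- `(TM ⊕ T*M)_ℂ = V ⊕ W` with `V`, `W` isotropic; `P` and `Q` are the projections onto `V` and
`W`, which map smooth sections to smooth sections. That they are idempotent need not be required:
isotropy implies it. -/
structure IsSplitting (V W : (x : M) → Submodule ℂ (GenTanC E x))
    (P Q : (x : M) → GenTanC E x →ₗ[ℂ] GenTanC E x) : Prop where
  isotropic_left : IsIsotropic V
  isotropic_right : IsIsotropic W
  mem_left : ∀ x e, P x e ∈ V x
  mem_right : ∀ x e, Q x e ∈ W x
  add_eq : ∀ x e, P x e + Q x e = e
  smooth_left : ∀ s, SmoothGenC s → SmoothGenC (fun x => P x (s x))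
  smooth_right : ∀ s, SmoothGenC s → SmoothGenC (fun x => Q x (s x))

namespace IsSplitting

variable {P Q : (x : M) → GenTanC E x →ₗ[ℂ] GenTanC E x} (h : IsSplitting V W P Q)

include h

theorem symm : IsSplitting W V Q P where
  isotropic_left := h.isotropic_right
  isotropic_right := h.isotropic_left
  mem_left := h.mem_right
  mem_right := h.mem_left
  add_eq x e := by rw [add_comm, h.add_eq]
  smooth_left := h.smooth_right
  smooth_right := h.smooth_left

/-- An isotropic subbundle with an isotropic complement is its own orthogonal complement. -/
theorem mem_of_orthogonal {x : M} {e : GenTanC E x} (he : ∀ v ∈ V x, pairingC E x e v = 0) :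
    e ∈ V x := by
  have h0 : Q x e = 0 := pairingC_nondegenerate fun w => by
    have h1 := he _ (h.mem_left x w)
    have h2 := h.isotropic_left x _ (h.mem_left x e) _ (h.mem_left x w)
    have h3 := h.isotropic_right x _ (h.mem_right x e) _ (h.mem_right x w)
    rw [← h.add_eq x e, map_add, LinearMap.add_apply, h2, zero_add] at h1
    rw [← h.add_eq x w, map_add, h1, h3, zero_add]
  rw [← h.add_eq x e, h0, add_zero]
  exact h.mem_left x e

theorem eq_zero_of_orthogonal {x : M} {e : GenTanC E x} (heV : e ∈ V x)
    (he : ∀ w ∈ W x, pairingC E x e w = 0) : e = 0 :=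
  pairingC_nondegenerate fun w => by
    rw [← h.add_eq x w, map_add, h.isotropic_left x _ heV _ (h.mem_left x w),
      he _ (h.mem_right x w), zero_add]

theorem left_eq {x : M} {e : GenTanC E x} (he : e ∈ V x) : P x e = e := by
  have h1 : Q x e ∈ V x := by
    rw [show Q x e = e - P x e from eq_sub_of_add_eq' (h.add_eq x e)]
    exact sub_mem he (h.mem_left x e)
  have h2 : Q x e = 0 := h.eq_zero_of_orthogonal h1 fun w hw =>
    h.isotropic_right x _ (h.mem_right x e) _ hw
  simpa [h2] using h.add_eq x e

theorem isSubbundle : IsSubbundle V := by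
  refine ⟨P, fun x => ⟨?_, le_antisymm ?_ ?_⟩, h.smooth_left⟩
  · ext1 e; exact h.left_eq (h.mem_left x e)
  · rintro _ ⟨e, rfl⟩; exact h.mem_left x e
  · intro e he; exact ⟨e, h.left_eq he⟩

theorem pairingC_eq (x : M) (a b : GenTanC E x) :
    pairingC E x a b = pairingC E x (Q x a) b + pairingC E x a (Q x b) := by
  have h1 := h.isotropic_left x _ (h.mem_left x a) _ (h.mem_left x b)
  have h2 := h.isotropic_right x _ (h.mem_right x a) _ (h.mem_right x b)
  have h3 := h.add_eq x a
  have h4 := h.add_eq x b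
  generalize P x a = a1 at *
  generalize P x b = b1 at *
  generalize Q x a = a2 at *
  generalize Q x b = b2 at *
  subst h3 h4
  simp only [map_add, LinearMap.add_apply, h1, h2]
  ring

theorem isPerfPair [∀ x : M, FiniteDimensional ℂ (GenTanC E x)] (x : M) :
    ((pairingC E x).domRestrict₁₂ (V x) (W x)).IsPerfPair := by
  refine LinearMap.IsPerfPair.of_injective ?_ ?_
  · rw [injective_iff_map_eq_zero]
    intro e he
    exact Subtype.ext (h.eq_zero_of_orthogonal e.2 fun w hw => congr($he ⟨w, hw⟩))
  · rw [injective_iff_map_eq_zero]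
    intro e he
    exact Subtype.ext (h.symm.eq_zero_of_orthogonal e.2 fun w hw =>
      (pairingC_comm _ _).trans congr($he ⟨w, hw⟩))

end IsSplitting

variable [FiniteDimensional ℝ E] [T2Space M]

theorem IsIsotropic.courantC_eq (hV : IsIsotropic V) {s t : (x : M) → V x} (hs : s ∈ sections V)
    (ht : t ∈ sections V) : courantC (fun x => (s x : GenTanC E x)) (fun x => (t x : GenTanC E x)) =
      dorfmanC (fun x => (s x : GenTanC E x)) (fun x => (t x : GenTanC E x)) :=
  courantC_eq_dorfmanC hs ht fun x => hV x _ (s x).2 _ (t x).2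

theorem IsIsotropic.dorfmanC_mem (hV : IsIsotropic V) (h : IsCourantClosed V)
    {s t : (x : M) → GenTanC E x} (hs : SmoothGenC s) (ht : SmoothGenC t)
    (hsV : ∀ x, s x ∈ V x) (htV : ∀ x, t x ∈ V x) (x : M) : dorfmanC s t x ∈ V x := by
  have h1 := (h (fun x => ⟨s x, hsV x⟩) hs (fun x => ⟨t x, htV x⟩) ht).2 x
  rwa [hV.courantC_eq hs ht] at h1

theorem IsIsotropic.dorfmanC_swap (hV : IsIsotropic V) {s t : (x : M) → V x} (hs : s ∈ sections V)
    (ht : t ∈ sections V) (x : M) :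
    dorfmanC (fun x => (s x : GenTanC E x)) (fun x => (t x : GenTanC E x)) x =
      -dorfmanC (fun x => (t x : GenTanC E x)) (fun x => (s x : GenTanC E x)) x := by
  rw [eq_neg_iff_add_eq_zero]
  refine pairingC_nondegenerate fun w => ?_
  obtain ⟨u, hu, rfl⟩ := exists_smoothGenC w
  have h := pairingC_dorfmanC_add hs ht hu x
  have h0 : (fun y => pairingC E y (s y) (t y)) = fun _ => 0 :=
    funext fun y => hV y _ (s y).2 _ (t y).2
  rw [h0, derC_zero] at h
  rw [map_add, LinearMap.add_apply, h]

theorem IsInduced.bracket_eq {𝒜 : LieAlgebroid E (sections V)} (h𝒜 : IsInduced 𝒜)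
    (hV : IsIsotropic V) {s t : (x : M) → V x} (hs : s ∈ sections V) (ht : t ∈ sections V) :
    (fun x => (𝒜.bracket s t x : GenTanC E x)) =
      dorfmanC (fun x => (s x : GenTanC E x)) (fun x => (t x : GenTanC E x)) := by
  rw [← hV.courantC_eq hs ht]
  exact funext fun x => h𝒜.2 s hs t ht x

/-- A Courant-closed isotropic subbundle is a Lie algebroid: on isotropic sections the bracket is
the Dorfman bracket, which satisfies the Jacobi and Leibniz identities, and it is skew there. -/
theorem exists_isInduced (hV : IsIsotropic V) (hsub : IsSubbundle V) (hc : IsCourantClosed V) :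
    ∃ 𝒜 : LieAlgebroid E (sections V), IsInduced 𝒜 := by
  obtain ⟨P, hP, hPs⟩ := hsub
  have hmem (x : M) (e : GenTanC E x) : P x e ∈ V x := (hP x).2 ▸ LinearMap.mem_range_self _ _
  have hfix (x : M) (e : GenTanC E x) (he : e ∈ V x) : P x e = e := by
    rw [← (hP x).2] at he
    obtain ⟨e', rfl⟩ := he
    exact congr($((hP x).1) e')
  -- The projection makes the bracket a section of `V` also for non-smooth arguments.
  let br (s t : (x : M) → V x) (x : M) : V x := ⟨P x (courantC
    (fun x => (s x : GenTanC E x)) (fun x => (t x : GenTanC E x)) x), hmem x _⟩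
  have hbr (s) (hs : s ∈ sections V) (t) (ht : t ∈ sections V) :
      (fun x => (br s t x : GenTanC E x)) =
      dorfmanC (fun x => (s x : GenTanC E x)) (fun x => (t x : GenTanC E x)) := by
    rw [← hV.courantC_eq hs ht]
    exact funext fun x => hfix x _ ((hc s hs t ht).2 x)
  have hbr' (s) (hs : s ∈ sections V) (t) (ht : t ∈ sections V) (x : M) :
      (br s t x : GenTanC E x) =
      dorfmanC (fun x => (s x : GenTanC E x)) (fun x => (t x : GenTanC E x)) x :=
    congrFun (hbr s hs t ht) x
  have hbm (s) (hs : s ∈ sections V) (t) (ht : t ∈ sections V) : br s t ∈ sections V := by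
    change SmoothGenC _
    rw [hbr s hs t ht]
    exact SmoothGenC.dorfmanC hs ht
  have hsw (s) (hs : s ∈ sections V) (t) (ht : t ∈ sections V) : br s t = -br t s := by
    funext x
    refine Subtype.ext ?_
    rw [hbr' s hs t ht, Pi.neg_apply, Submodule.coe_neg, hbr' t ht s hs]
    exact hV.dorfmanC_swap hs ht x
  have hadd (s) (hs : s ∈ sections V) (t) (ht : t ∈ sections V) (u) (hu : u ∈ sections V) :
      br s (t + u) = br s t + br s u := by
    funext x
    refine Subtype.ext ?_
    rw [Pi.add_apply, Submodule.coe_add, hbr' s hs t ht, hbr' s hs u hu,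
      hbr' s hs (t + u) (SmoothGenC.add ht hu)]
    exact congrFun (dorfmanC_add hs ht hu) x
  refine ⟨{
    anchor := fun x => (rho E x).domRestrict (V x)
    anchor_smooth := fun s hs => ⟨hs.1.1, hs.2.1⟩
    bracket := br
    bracket_mem := hbm
    bracket_add := hadd
    bracket_skew := hsw
    jacobi := ?_
    leibniz := ?_
    anchor_bracket := ?_ }, fun _ _ => rfl, ?_⟩
  · intro s hs t ht u hu
    have h1 : br s (br t u) = br (br s t) u + br t (br s u) := by
      funext x
      refine Subtype.ext ?_
      rw [Pi.add_apply, Submodule.coe_add, hbr' s hs _ (hbm t ht u hu),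
        hbr' _ (hbm s hs t ht) u hu, hbr' t ht _ (hbm s hs u hu), hbr s hs t ht, hbr t ht u hu,
        hbr s hs u hu]
      exact congrFun (dorfmanC_dorfmanC hs ht hu) x
    have h2 : br t (br s u) + br t (br u s) = 0 := by
      have h0 : br s u + br u s = 0 := by rw [hsw s hs u hu, neg_add_cancel]
      have hm : (0 : (x : M) → V x) ∈ sections V :=
        h0 ▸ SmoothGenC.add (hbm s hs u hu) (hbm u hu s hs)
      have h3 := hadd t ht 0 hm 0 hm
      rw [add_zero, left_eq_add] at h3
      rw [← hadd t ht _ (hbm s hs u hu) _ (hbm u hu s hs), h0, h3]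
    rw [hsw _ (hbm t ht u hu) s hs, hsw _ (hbm u hu s hs) t ht, h1, eq_neg_of_add_eq_zero_left h2]
    abel
  · intro s hs t ht f hf x
    refine Subtype.ext ?_
    rw [Submodule.coe_add, Submodule.coe_smul, Submodule.coe_smul, hbr' s hs t ht,
      hbr' s hs _ (SmoothGenC.fun_smul hf ht)]
    exact dorfmanC_fun_smul hf hs ht x
  · intro s hs t ht x
    change rho E x (br s t x : GenTanC E x) = _
    rw [hbr' s hs t ht]
    rfl
  · intro s hs t ht x
    rw [hV.courantC_eq hs ht]
    exact hbr' s hs t ht x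

namespace IsSplitting

variable {P Q : (x : M) → GenTanC E x →ₗ[ℂ] GenTanC E x} (h : IsSplitting V W P Q)

include h

/-- The differential of `W = V*` is given by the Dorfman bracket: `(d_W Y)(ξ, ζ) = -⟨Y ∘ ξ, ζ⟩`. -/
theorem dualDifferential_eq {ℬ : LieAlgebroid E (sections W)} (hℬ : IsInduced ℬ)
    {Y : (x : M) → V x} (hY : Y ∈ sections V) {ξ ζ : (x : M) → W x} (hξ : ξ ∈ sections W)
    (hζ : ζ ∈ sections W) (x : M) :
    dualDifferential ℬ (fun x => (pairingC E x).domRestrict₁₂ (V x) (W x)) Y ξ ζ x =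
      -pairingC E x (dorfmanC (fun x => (Y x : GenTanC E x)) (fun x => (ξ x : GenTanC E x)) x)
        (ζ x) := by
  have h1 := derC_pairingC hξ hY hζ x
  have h2 := pairingC_dorfmanC_add hY hξ hζ x
  have h3 := congrFun (hℬ.bracket_eq h.isotropic_right hξ hζ) x
  simp only [dualDifferential, hℬ.anchor_eq, LinearMap.domRestrict₁₂_apply, h3]
  linear_combination h1 + h2

/-- Two complementary isotropic subbundles with their induced Lie algebroid structures form a Lie
bialgebroid. With `(d_W Y)(ξ, ζ) = -⟨Y ∘ ξ, ζ⟩`, compatibility is the Jacobi identity of the Dorfman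
bracket, evaluated on `X`, `Y`, `ξ` and paired with `ζ`. -/
theorem isLieBialgebroid [∀ x : M, FiniteDimensional ℂ (GenTanC E x)]
    {𝒜 : LieAlgebroid E (sections V)} (h𝒜 : IsInduced 𝒜)
    {ℬ : LieAlgebroid E (sections W)} (hℬ : IsInduced ℬ) :
    IsLieBialgebroid 𝒜 ℬ (fun x => (pairingC E x).domRestrict₁₂ (V x) (W x)) := by
  refine ⟨h.isPerfPair, fun X hX ξ hξ => SmoothGenC.pairingC hX hξ, ?_⟩
  -- `L_X ξ` is the component in `W` of `X ∘ ξ`: its component in `V` is orthogonal to `V`.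
  let 𝓛 (X : (x : M) → V x) (ξ : (x : M) → W x) (x : M) : W x :=
    ⟨Q x (dorfmanC (fun x => (X x : GenTanC E x)) (fun x => (ξ x : GenTanC E x)) x),
      h.mem_right x _⟩
  have hL (X) (hX : X ∈ sections V) (ξ) (hξ : ξ ∈ sections W) : 𝓛 X ξ ∈ sections W :=
    h.smooth_right _ (SmoothGenC.dorfmanC hX hξ)
  refine ⟨𝓛, fun X hX ξ hξ => ⟨hL X hX ξ hξ, fun Z hZ x => ?_⟩, fun X hX Y hY ξ hξ ζ hζ x => ?_⟩
  · have h1 := derC_pairingC hX hZ hξ x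
    have h2 := congrFun (h𝒜.bracket_eq h.isotropic_left hX hZ) x
    have h3 := h.isotropic_left x _ (Z x).2 _ (h.mem_left x
      (dorfmanC (fun x => (X x : GenTanC E x)) (fun x => (ξ x : GenTanC E x)) x))
    rw [← h.add_eq x (dorfmanC (fun x => (X x : GenTanC E x)) (fun x => (ξ x : GenTanC E x)) x),
      map_add, h3] at h1
    simp only [h𝒜.anchor_eq, LinearMap.domRestrict₁₂_apply, h2]
    linear_combination -h1
  · have hXY : 𝒜.bracket X Y ∈ sections V := 𝒜.bracket_mem X hX Y hY
    have e0 := congrFun (dorfmanC_dorfmanC hX hY hξ) x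
    have e1 (X) (hX : X ∈ sections V) (Y) (hY : Y ∈ sections V) :=
      derC_pairingC hX (SmoothGenC.dorfmanC hY hξ) hζ x
    have e2 (X) (hX : X ∈ sections V) (Y) (hY : Y ∈ sections V) :
        0 = pairingC E x (dorfmanC (fun x => (Y x : GenTanC E x))
            (fun x => (𝓛 X ξ x : GenTanC E x)) x) (ζ x) +
          pairingC E x (𝓛 X ξ x)
            (dorfmanC (fun x => (Y x : GenTanC E x)) (fun x => (ζ x : GenTanC E x)) x) := by
      have := derC_pairingC hY (hL X hX ξ hξ) hζ x
      have h0 : (fun y => pairingC E y (𝓛 X ξ y) (ζ y)) = fun _ => 0 :=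
        funext fun y => h.isotropic_right y _ (𝓛 X ξ y).2 _ (ζ y).2
      rwa [h0, derC_zero] at this
    have e3 (X Y : (x : M) → V x) :
        pairingC E x (dorfmanC (fun x => (X x : GenTanC E x)) (fun x => (ξ x : GenTanC E x)) x)
          (dorfmanC (fun x => (Y x : GenTanC E x)) (fun x => (ζ x : GenTanC E x)) x) =
        pairingC E x (𝓛 X ξ x)
            (dorfmanC (fun x => (Y x : GenTanC E x)) (fun x => (ζ x : GenTanC E x)) x) +
          pairingC E x (dorfmanC (fun x => (X x : GenTanC E x)) (fun x => (ξ x : GenTanC E x)) x)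
            (𝓛 Y ζ x) := h.pairingC_eq x _ _
    rw [h.dualDifferential_eq hℬ hXY hξ hζ, h𝒜.bracket_eq h.isotropic_left hX hY]
    simp only [lieTwo, h𝒜.anchor_eq]
    change _ = derC _ (fun y => _) _ - _ - _ - (derC _ (fun y => _) _ - _ - _)
    rw [h.dualDifferential_eq hℬ hY (hL X hX ξ hξ) hζ,
      h.dualDifferential_eq hℬ hY hξ (hL X hX ζ hζ),
      h.dualDifferential_eq hℬ hX (hL Y hY ξ hξ) hζ, h.dualDifferential_eq hℬ hX hξ (hL Y hY ζ hζ)]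
    simp only [h.dualDifferential_eq hℬ hY hξ hζ, h.dualDifferential_eq hℬ hX hξ hζ, derC_neg,
      e1 X hX Y hY, e1 Y hY X hX, e0, Pi.add_apply, map_add, LinearMap.add_apply]
    linear_combination e2 X hX Y hY - e2 Y hY X hX - e3 X Y + e3 Y X

end IsSplitting

end Isotropic

/-! ### Real vectors and conjugation in a complexification -/

namespace Cplx

variable {V W U : Type*} [AddCommGroup V] [AddCommGroup W] [AddCommGroup U]

/-- Complex conjugation. -/
def conj (v : Cplx V) : Cplx V := mk v.re (-v.im)

@[simp] theorem re_conj (v : Cplx V) : v.conj.re = v.re := rfl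
@[simp] theorem im_conj (v : Cplx V) : v.conj.im = -v.im := rfl

variable [Module ℝ V] [Module ℝ W] [Module ℝ U]

theorem eq_ofReal_add (v : Cplx V) : v = ofReal v.re + Complex.I • ofReal v.im := by
  ext <;> simp

theorem ofReal_smul (a : ℝ) (v : V) : ofReal (a • v) = (a : ℂ) • ofReal v := by
  ext <;> simp [-Complex.coe_smul]

theorem sub_I_smul (v w : Cplx V) : v - Complex.I • w = v + (-Complex.I) • w := by
  rw [neg_smul, sub_eq_add_neg]

theorem mem_of_ofReal_mem {A : Cplx V →ₗ[ℂ] Cplx W} {S : Submodule ℂ (Cplx W)}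
    (h : ∀ v, A (ofReal v) ∈ S) (v : Cplx V) : A v ∈ S := by
  rw [eq_ofReal_add v, map_add, map_smul]
  exact add_mem (h _) (S.smul_mem _ (h _))

theorem extend_ofReal (f : V →ₗ[ℝ] W) (v : V) : extend f (ofReal v) = ofReal (f v) := by
  ext <;> simp [extend]

theorem extendBilin_ofReal (b : V →ₗ[ℝ] W →ₗ[ℝ] ℝ) (v : V) (w : W) :
    extendBilin b (ofReal v) (ofReal w) = (b v w : ℂ) := by
  apply Complex.ext <;> simp [extendBilin]

instance [FiniteDimensional ℝ V] : FiniteDimensional ℂ (Cplx V) := by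
  obtain ⟨s, hs⟩ := (Module.finite_def (R := ℝ) (M := V)).1 inferInstance
  refine Module.Finite.of_fg_top (R := ℂ)
    (Submodule.fg_def.2 ⟨ofReal '' (s : Set V), s.finite_toSet.image _, eq_top_iff.2 ?_⟩)
  have h (v : V) : ofReal v ∈ Submodule.span ℂ (ofReal '' (s : Set V)) := by
    have hv : v ∈ Submodule.span ℝ (s : Set V) := hs ▸ Submodule.mem_top
    induction hv using Submodule.span_induction with
    | mem v hv => exact Submodule.subset_span ⟨v, hv, rfl⟩
    | zero => exact zero_mem _
    | add v w _ _ hv hw =>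
      convert add_mem hv hw using 1
      ext <;> simp
    | smul a v _ hv =>
      have h : ofReal (a • v) = (a : ℂ) • ofReal v := ofReal_smul a v
      exact h ▸ Submodule.smul_mem _ (a : ℂ) hv
  intro v _
  rw [eq_ofReal_add v]
  exact add_mem (h _) (Submodule.smul_mem _ _ (h _))

theorem extend₂_conj (b : V →ₗ[ℝ] W →ₗ[ℝ] U) (v : Cplx V) (w : Cplx W) :
    extend₂ b v.conj w.conj = (extend₂ b v w).conj := by
  ext <;> simp [add_comm]

theorem extendBilin_conj (b : V →ₗ[ℝ] W →ₗ[ℝ] ℝ) (v : Cplx V) (w : Cplx W) :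
    extendBilin b v.conj w.conj = starRingEnd ℂ (extendBilin b v w) := by
  apply Complex.ext <;> simp [extendBilin, add_comm]

theorem extend_conj (f : V →ₗ[ℝ] W) (v : Cplx V) : extend f v.conj = (extend f v).conj := by
  ext <;> simp [extend]

end Cplx

/-! ### Smooth endomorphisms and the cyclic invariance of the Dorfman bracket -/

variable {E : Type*} [NormedAddCommGroup E] [NormedSpace ℝ E]
  {M : Type*} [TopologicalSpace M] [ChartedSpace E M]

instance [FiniteDimensional ℝ E] (x : M) : FiniteDimensional ℝ (GenTan E x) :=
  inferInstanceAs (FiniteDimensional ℝ (E × (E →L[ℝ] ℝ)))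

/-- `α ∘ (Y + β) = -ι_Y dα`. -/
theorem dorfman_form (α : (x : M) → Cotan E x) (t : (x : M) → GenTan E x) (x : M) :
    dorfman (fun y => (0, α y)) t x = (0, -dForm α x (t x).1) := by
  have h1 : VectorField.mlieBracket 𝓘(ℝ, E) (fun y : M => (0 : Tan E y)) (fun y => (t y).1) x = 0 :=
    congrFun VectorField.mlieBracket_zero_left x
  have h2 : lieForm (fun y : M => (0 : Tan E y)) (fun y => (t y).2) x = 0 := by
    simp [lieForm, mvfderiv_const]
  simp only [dorfman, h1, h2, zero_sub]

variable [IsManifold 𝓘(ℝ, E) ∞ M]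

theorem dForm_zero (x : M) : dForm (fun y : M => (0 : Cotan E y)) x = 0 := by
  have h : chartForm x (fun y : M => (0 : Cotan E y)) = fun _ => 0 :=
    funext fun _ => ContinuousLinearMap.zero_comp _
  ext u v
  rw [dForm_eq, h, fderiv_const_apply]
  exact sub_self (0 : ℝ)

section Smooth

theorem SmoothGenC.conj {s : (x : M) → GenTanC E x} (hs : SmoothGenC s) :
    SmoothGenC (fun x => (s x).conj) := by
  obtain ⟨S, rfl⟩ := hs.exists_eq
  exact smoothGenC_valGenC S.conj

/-- A family of endomorphisms of the fibres that maps smooth sections to smooth sections. -/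
def SmoothEnd (P : (x : M) → GenTanC E x →ₗ[ℂ] GenTanC E x) : Prop :=
  ∀ s, SmoothGenC s → SmoothGenC (fun x => P x (s x))

variable {P Q : (x : M) → GenTanC E x →ₗ[ℂ] GenTanC E x}

theorem SmoothEnd.add (hP : SmoothEnd P) (hQ : SmoothEnd Q) : SmoothEnd (fun x => P x + Q x) :=
  fun s hs => (hP s hs).add (hQ s hs)

theorem SmoothEnd.smul (hP : SmoothEnd P) (c : ℂ) : SmoothEnd (fun x => c • P x) :=
  fun s hs => (hP s hs).fun_smul contMDiff_const

theorem SmoothEnd.id : SmoothEnd (fun x : M => (LinearMap.id : GenTanC E x →ₗ[ℂ] _)) :=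
  fun _ hs => hs

theorem SmoothEnd.extend {T : (x : M) → GenTan E x →ₗ[ℝ] GenTan E x}
    (h : ∀ s, SmoothGen s → SmoothGen (fun x => T x (s x))) :
    SmoothEnd (fun x => Cplx.extend (T x)) :=
  fun _ hs => ⟨h _ hs.1, h _ hs.2⟩

end Smooth

section Dorfman

variable [FiniteDimensional ℝ E] [T2Space M]

theorem dorfmanC_conj {s t : (x : M) → GenTanC E x} (hs : SmoothGenC s) (ht : SmoothGenC t)
    (x : M) : dorfmanC (fun x => (s x).conj) (fun x => (t x).conj) x = (dorfmanC s t x).conj := by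
  obtain ⟨S, rfl⟩ := hs.exists_eq
  obtain ⟨T, rfl⟩ := ht.exists_eq
  exact congrArg (fun A => valGenC A x) (Cplx.extend₂_conj (cartan E M).dorf S T)

/-- On pairwise orthogonal sections `⟨s ∘ t, u⟩` is invariant under cyclic permutations (it is even
alternating). Since it is linear over functions in `u`, it is then tensorial in all arguments. -/
theorem pairingC_dorfmanC_cyclic {s t u : (x : M) → GenTanC E x} (hs : SmoothGenC s)
    (ht : SmoothGenC t) (hu : SmoothGenC u) (htu : ∀ x, pairingC E x (t x) (u x) = 0)
    (hus : ∀ x, pairingC E x (u x) (s x) = 0) (x : M) :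
    pairingC E x (dorfmanC s t x) (u x) = pairingC E x (dorfmanC u s x) (t x) := by
  have h1 := derC_pairingC hs ht hu x
  have h2 := pairingC_dorfmanC_add hu hs ht x
  rw [funext htu, derC_zero] at h1
  rw [funext hus, derC_zero] at h2
  linear_combination -h1 - h2 - pairingC_comm (t x) (dorfmanC s u x)

end Dorfman

/-! ### The splitting of a generalized almost contact structure -/

namespace AlmostContact

variable (J : AlmostContact E M)

/-- The one-form `η` as a section of `(TM ⊕ T*M)_ℂ`. -/
def etaC (x : M) : GenTanC E x := Cplx.ofReal (0, J.η x)

/-- `η ∘ (Y + β) = -ι_Y dη`, so `dη` is up to the factor `-2` the component `⟨η ∘ u, v⟩` of the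
Dorfman bracket. -/
theorem pullbackDEta_eq {x : M} (u v : (x : M) → GenTanC E x) :
    J.pullbackDEta x (u x) (v x) = -2 * pairingC E x (dorfmanC J.etaC u x) (v x) := by
  have h (t : (x : M) → GenTan E x) := dorfman_form J.η t x
  have h0 (t : (x : M) → GenTan E x) := dorfman_form (fun y : M => (0 : Cotan E y)) t x
  simp only [dForm_zero] at h0
  have h1 : dorfmanC J.etaC u x = Cplx.mk (0, -dForm J.η x (u x).re.1)
      (0, -dForm J.η x (u x).im.1) := by
    refine Cplx.ext ((congrArg₂ (· - ·) (h _) (h0 _)).trans ?_)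
      ((congrArg₂ (· + ·) (h _) (h0 _)).trans ?_)
    · simp
    · simp
  rw [h1]
  apply Complex.ext
  · simp [pullbackDEta, pairingC, pairing, Cplx.extendBilin, rho, Cplx.extend]
    ring
  · simp [pullbackDEta, pairingC, pairing, Cplx.extendBilin, rho, Cplx.extend]
    ring


/-- The projection onto `L_F`, `X + α ↦ η(X) F`. -/
def projF (x : M) : GenTan E x →ₗ[ℝ] GenTan E x where
  toFun e := (J.η x e.1 • J.F x, 0)
  map_add' e f := by simp [add_smul]
  map_smul' c e := by simp [mul_smul]

/-- The projection onto `L_η`, `X + α ↦ α(F) η`. -/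
def projEta (x : M) : GenTan E x →ₗ[ℝ] GenTan E x where
  toFun e := (0, e.2 (J.F x) • J.η x)
  map_add' e f := by simp [add_smul]
  map_smul' c e := by simp [mul_smul]

/-- The projection onto `ker η ⊕ ker F` along the span of `F` and `η`. -/
def projKer (x : M) : GenTan E x →ₗ[ℝ] GenTan E x :=
  LinearMap.id - J.projF x - J.projEta x

theorem projKer_mem (x : M) (e : GenTan E x) : J.projKer x e ∈ J.kerBundle x := by
  constructor
  · simp [projKer, projF, projEta, J.η_F]
  · simp [projKer, projF, projEta, J.η_F]

theorem Phi_projKer (x : M) (e : GenTan E x) : J.Phi x (J.projKer x e) = J.Phi x e := by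
  have h1 : J.Phi x (J.projF x e) = 0 := by simp [Phi, projF, J.φ_F, J.θ_F]
  have h2 : J.Phi x (J.projEta x e) = 0 := by simp [Phi, projEta, J.π_η, J.η_φ]
  simp [projKer, h1, h2]

/-- For `ε = -i` this is the projection onto `E10`, for `ε = i` the projection onto `E01`: on a real
vector `e` of `ker η ⊕ ker F` it is `(e + ε Φ(e)) / 2`. -/
def projE (ε : ℂ) (x : M) : GenTanC E x →ₗ[ℂ] GenTanC E x :=
  (1 / 2 : ℂ) • (Cplx.extend (J.projKer x) + ε • Cplx.extend (J.Phi x))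

theorem projE_ofReal (ε : ℂ) (x : M) (e : GenTan E x) :
    J.projE ε x (Cplx.ofReal e) = Cplx.ofReal (J.projKer x ((1 / 2 : ℝ) • e)) +
      ε • Cplx.ofReal (J.Phi x (J.projKer x ((1 / 2 : ℝ) • e))) := by
  have h (a : GenTan E x) : Cplx.ofReal ((1 / 2 : ℝ) • a) = (1 / 2 : ℂ) • Cplx.ofReal a := by
    ext1 <;> simp
  rw [projE, Phi_projKer, map_smul, map_smul, h, h]
  simp only [LinearMap.smul_apply, LinearMap.add_apply, Cplx.extend_ofReal]
  module

theorem projE_mem_E10 (x : M) (w : GenTanC E x) : J.projE (-Complex.I) x w ∈ J.E10 x :=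
  Cplx.mem_of_ofReal_mem (S := J.E10 x) (fun e => ⟨_, J.projKer_mem x _,
    (J.projE_ofReal _ x e).trans (Cplx.sub_I_smul _ _).symm⟩) w

theorem projE_mem_E01 (x : M) (w : GenTanC E x) : J.projE Complex.I x w ∈ J.E01 x :=
  Cplx.mem_of_ofReal_mem (S := J.E01 x) (fun e => ⟨_, J.projKer_mem x _, J.projE_ofReal _ x e⟩) w

theorem projF_mem (x : M) (w : GenTanC E x) : Cplx.extend (J.projF x) w ∈ J.LF x := by
  refine Cplx.mem_of_ofReal_mem (fun e => ?_) w
  refine Submodule.mem_span_singleton.2 ⟨(J.η x e.1 : ℂ), ?_⟩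
  rw [Cplx.extend_ofReal, ← Cplx.ofReal_smul]
  exact congrArg Cplx.ofReal (Prod.ext rfl (smul_zero _))

theorem extend_projEta (x : M) (w : GenTanC E x) : ∃ c : ℂ,
    Cplx.extend (J.projEta x) w = c • J.etaC x := by
  refine ⟨⟨w.re.2 (J.F x), w.im.2 (J.F x)⟩, ?_⟩
  ext1 <;> simp [projEta, Cplx.extend, etaC]

/-- `Φ` is skew for the pairing. -/
theorem pairing_Phi (x : M) (e f : GenTan E x) :
    pairing E x (J.Phi x e) f = -pairing E x e (J.Phi x f) := by
  have h1 := J.skew_π x e.2 f.2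
  have h2 := J.skew_θ x e.1 f.1
  simp [pairing, Phi, h1, h2]
  ring

theorem pairing_F (x : M) {e : GenTan E x} (he : e ∈ J.kerBundle x) :
    pairing E x (J.F x, 0) e = 0 := by
  simp [pairing, he.2]

theorem pairing_eta (x : M) {e : GenTan E x} (he : e ∈ J.kerBundle x) :
    pairing E x (0, J.η x) e = 0 := by
  simp [pairing, he.1]

/-- Isotropy of `L` (`ε = -i`, `l = F`) and `L*` (`ε = i`, `l = η`): `Φ` is skew with `Φ² = -1`, so
`⟨Φ e, Φ f⟩ = ⟨e, f⟩`, and `l` is null and orthogonal to `ker η ⊕ ker F`. -/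
theorem pairingC_isotropic {ε : ℂ} (hε : ε * ε = -1) (x : M) {l e f : GenTan E x} (c d : ℂ)
    (hl : pairing E x l l = 0) (hlk : ∀ e ∈ J.kerBundle x, pairing E x l e = 0)
    (he : e ∈ J.kerBundle x) (hf : f ∈ J.kerBundle x) :
    pairingC E x (c • Cplx.ofReal l + (Cplx.ofReal e + ε • Cplx.ofReal (J.Phi x e)))
      (d • Cplx.ofReal l + (Cplx.ofReal f + ε • Cplx.ofReal (J.Phi x f))) = 0 := by
  have hr (a b : GenTan E x) : pairingC E x (Cplx.ofReal a) (Cplx.ofReal b) = pairing E x a b :=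
    Cplx.extendBilin_ofReal _ a b
  have hc (a b : GenTan E x) : pairing E x a b = pairing E x b a := by
    simp [pairing, add_comm]
  have h1 := J.pairing_Phi x e f
  have h2 := J.pairing_Phi x e (J.Phi x f)
  rw [J.Phi_Phi x hf, map_neg, neg_neg] at h2
  simp only [map_add, map_smul, LinearMap.add_apply, LinearMap.smul_apply, smul_eq_mul, hr, hl,
    hc _ l, hlk _ he, hlk _ hf, hlk _ (J.Phi_mem_kerBundle x _), h1, h2]
  push_cast
  linear_combination (pairing E x e f : ℂ) * hε

theorem isIsotropic_L : IsIsotropic J.L := by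
  intro x u hu v hv
  obtain ⟨_, h1, _, ⟨e, he, rfl⟩, rfl⟩ := Submodule.mem_sup.1 hu
  obtain ⟨_, h2, _, ⟨f, hf, rfl⟩, rfl⟩ := Submodule.mem_sup.1 hv
  obtain ⟨c, rfl⟩ := Submodule.mem_span_singleton.1 h1
  obtain ⟨d, rfl⟩ := Submodule.mem_span_singleton.1 h2
  rw [Cplx.sub_I_smul, Cplx.sub_I_smul]
  exact J.pairingC_isotropic (by simp) x c d (by simp [pairing]) (fun _ => J.pairing_F x) he hf

theorem isIsotropic_Lstar : IsIsotropic J.Lstar := by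
  intro x u hu v hv
  obtain ⟨_, h1, _, ⟨e, he, rfl⟩, rfl⟩ := Submodule.mem_sup.1 hu
  obtain ⟨_, h2, _, ⟨f, hf, rfl⟩, rfl⟩ := Submodule.mem_sup.1 hv
  obtain ⟨c, rfl⟩ := Submodule.mem_span_singleton.1 h1
  obtain ⟨d, rfl⟩ := Submodule.mem_span_singleton.1 h2
  exact J.pairingC_isotropic (by simp) x c d (by simp [pairing]) (fun _ => J.pairing_eta x) he hf


/-- The projection onto `L` along `L*`. -/
def projL (x : M) : GenTanC E x →ₗ[ℂ] GenTanC E x :=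
  Cplx.extend (J.projF x) + J.projE (-Complex.I) x

/-- The projection onto `L*` along `L`. -/
def projLstar (x : M) : GenTanC E x →ₗ[ℂ] GenTanC E x :=
  Cplx.extend (J.projEta x) + J.projE Complex.I x

theorem projL_add_projLstar (x : M) (w : GenTanC E x) : J.projL x w + J.projLstar x w = w := by
  have h : Cplx.extend (J.projKer x) w =
      w - Cplx.extend (J.projF x) w - Cplx.extend (J.projEta x) w := rfl
  simp only [projL, projLstar, projE, LinearMap.add_apply, LinearMap.smul_apply, h]
  module

theorem smoothEnd_projF : SmoothEnd (fun x => Cplx.extend (J.projF x)) := by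
  refine SmoothEnd.extend fun s hs => ⟨?_, ?_⟩
  · exact SmoothVec.fun_smul (J.smooth_η.apply hs.1) J.smooth_F
  · exact (0 : OneForm E M).2

theorem smoothEnd_projEta : SmoothEnd (fun x => Cplx.extend (J.projEta x)) := by
  refine SmoothEnd.extend fun s hs => ⟨?_, ?_⟩
  · exact (0 : VecField E M).2
  · exact SmoothForm.fun_smul (hs.2.apply J.smooth_F) J.smooth_η

section Splitting

variable [FiniteDimensional ℝ E] [T2Space M]

theorem smoothEnd_Phi : SmoothEnd (fun x => Cplx.extend (J.Phi x)) := by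
  refine SmoothEnd.extend fun s hs => ⟨?_, ?_⟩
  · exact SmoothVec.add (J.smooth_φ.clm_bundle_apply hs.1) (J.smooth_π.clm_bundle_apply hs.2)
  · refine smoothForm_of_apply fun X hX => ?_
    have h1 : SmoothForm fun x => J.θ x (s x).1 := J.smooth_θ.clm_bundle_apply hs.1
    have h2 : SmoothVec fun x => J.φ x (X x) := J.smooth_φ.clm_bundle_apply hX
    exact (h1.apply hX).sub (hs.2.apply h2)

theorem smoothEnd_projE (ε : ℂ) : SmoothEnd (J.projE ε) := by
  have h : SmoothEnd (fun x => Cplx.extend (J.projKer x)) := by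
    convert (SmoothEnd.id.add (J.smoothEnd_projF.smul (-1))).add (J.smoothEnd_projEta.smul (-1))
      using 2 with x
    ext1 w
    have h : Cplx.extend (J.projKer x) w =
      w - Cplx.extend (J.projF x) w - Cplx.extend (J.projEta x) w := rfl
    simp only [h, LinearMap.add_apply, LinearMap.smul_apply, LinearMap.id_apply]
    module
  exact (h.add (J.smoothEnd_Phi.smul ε)).smul _

theorem isSplitting : IsSplitting J.L J.Lstar J.projL J.projLstar where
  isotropic_left := J.isIsotropic_L
  isotropic_right := J.isIsotropic_Lstar
  mem_left x w := Submodule.add_mem_sup (J.projF_mem x w) (J.projE_mem_E10 x w)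
  mem_right x w := by
    refine Submodule.add_mem_sup ?_ (J.projE_mem_E01 x w)
    obtain ⟨c, hc⟩ := J.extend_projEta x w
    exact Submodule.mem_span_singleton.2 ⟨c, hc.symm⟩
  add_eq := J.projL_add_projLstar
  smooth_left := J.smoothEnd_projF.add (J.smoothEnd_projE _)
  smooth_right := J.smoothEnd_projEta.add (J.smoothEnd_projE _)

end Splitting

/-! ### Involutivity of `L*` and the type of `dη` -/

theorem smoothGenC_etaC : SmoothGenC J.etaC :=
  ⟨⟨(0 : VecField E M).2, J.smooth_η⟩, (0 : VecField E M).2, (0 : OneForm E M).2⟩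

theorem etaC_mem (x : M) : J.etaC x ∈ J.Lstar x :=
  Submodule.mem_sup_left (Submodule.mem_span_singleton_self _)

theorem conj_mem_E10 {x : M} {w : GenTanC E x} (hw : w ∈ J.E01 x) : w.conj ∈ J.E10 x := by
  obtain ⟨e, he, rfl⟩ := hw
  exact ⟨e, he, by ext1 <;> simp⟩

theorem conj_mem_E01 {x : M} {w : GenTanC E x} (hw : w ∈ J.E10 x) : w.conj ∈ J.E01 x := by
  obtain ⟨e, he, rfl⟩ := hw
  exact ⟨e, he, by ext1 <;> simp⟩

theorem pullbackDEta_conj {x : M} (u v : GenTanC E x) :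
    J.pullbackDEta x u.conj v.conj = starRingEnd ℂ (J.pullbackDEta x u v) := by
  simp only [pullbackDEta, LinearMap.compl₁₂_apply, rho, Cplx.extend_conj, Cplx.extendBilin_conj]

/-- As `dη` is real, the two vanishing conditions in the definition of type `(1,1)` are conjugate
to each other. -/
theorem isTypeOneOne_iff :
    J.IsTypeOneOne ↔ ∀ x, ∀ u ∈ J.E01 x, ∀ v ∈ J.E01 x, J.pullbackDEta x u v = 0 := by
  refine ⟨fun h x => (h x).2, fun h x => ⟨fun u hu v hv => ?_, h x⟩⟩
  have h1 := h x _ (J.conj_mem_E01 hu) _ (J.conj_mem_E01 hv)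
  rwa [pullbackDEta_conj, map_eq_zero] at h1

/-- Type `(1,1)` gives vanishing on all of `L*`, as the anchor kills `η`. -/
theorem pullbackDEta_eq_zero (h : J.IsTypeOneOne) {x : M} {u v : GenTanC E x}
    (hu : u ∈ J.Lstar x) (hv : v ∈ J.Lstar x) : J.pullbackDEta x u v = 0 := by
  obtain ⟨_, h1, u, hu', rfl⟩ := Submodule.mem_sup.1 hu
  obtain ⟨_, h2, v, hv', rfl⟩ := Submodule.mem_sup.1 hv
  obtain ⟨c, rfl⟩ := Submodule.mem_span_singleton.1 h1
  obtain ⟨d, rfl⟩ := Submodule.mem_span_singleton.1 h2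
  have hρ : rho E x (Cplx.ofReal (0, J.η x)) = 0 := Cplx.extend_ofReal _ _
  have h3 := (h x).2 u hu' v hv'
  simp only [pullbackDEta, LinearMap.compl₁₂_apply] at h3 ⊢
  simp [hρ, h3]

variable [FiniteDimensional ℝ E] [T2Space M]

theorem exists_section_E01 {x : M} {w : GenTanC E x} (hw : w ∈ J.E01 x) :
    ∃ s, SmoothGenC s ∧ (∀ y, s y ∈ J.E01 y) ∧ s x = w := by
  obtain ⟨s, hs, rfl⟩ := exists_smoothGenC w
  refine ⟨fun y => J.projE Complex.I y (s y), J.smoothEnd_projE _ s hs,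
    fun y => J.projE_mem_E01 y _, ?_⟩
  have h1 := J.isSplitting.symm.left_eq (Submodule.mem_sup_right hw)
  have h2 : Cplx.extend (J.projEta x) (s x) = 0 := by
    obtain ⟨e, he, hw⟩ := hw
    have hre : (s x).re = e := by rw [hw]; simp
    have him : (s x).im = J.Phi x e := by rw [hw]; simp
    have h3 (e) (he : e ∈ J.kerBundle x) : J.projEta x e = 0 := by simp [projEta, he.2]
    exact Cplx.ext ((congrArg (J.projEta x) hre).trans (h3 e he))
      ((congrArg (J.projEta x) him).trans (h3 _ (J.Phi_mem_kerBundle x e)))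
  rw [projLstar, LinearMap.add_apply, h2, zero_add] at h1
  exact h1

/-- For `u`, `v` in `E01`, `⟨u ∘ v, η⟩ = 0` if `L*` is involutive, and cyclically this is a multiple
of `dη(ρ(u), ρ(v))`. -/
theorem isTypeOneOne_of_isCourantClosed (h : IsCourantClosed J.Lstar) : J.IsTypeOneOne := by
  refine J.isTypeOneOne_iff.2 fun x u hu v hv => ?_
  obtain ⟨s, hs, hsm, rfl⟩ := J.exists_section_E01 hu
  obtain ⟨t, ht, htm, rfl⟩ := J.exists_section_E01 hv
  have hI := J.isIsotropic_Lstar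
  have hsm' (y) : s y ∈ J.Lstar y := Submodule.mem_sup_right (hsm y)
  have htm' (y) : t y ∈ J.Lstar y := Submodule.mem_sup_right (htm y)
  have h1 := hI.dorfmanC_mem h hs ht hsm' htm' x
  rw [pullbackDEta_eq, ← pairingC_dorfmanC_cyclic hs ht J.smoothGenC_etaC
    (fun y => hI y _ (htm' y) _ (J.etaC_mem y)) (fun y => hI y _ (J.etaC_mem y) _ (hsm' y)),
    hI x _ h1 _ (J.etaC_mem x), mul_zero]

/-- `⟨s ∘ t, u⟩ = 0` for sections of `E01`: this is conjugate to the involutivity of `L`, which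
contains `E10`. -/
theorem pairingC_dorfmanC_E01 (hJ : J.IsGeneralizedContact) {s t u : (x : M) → GenTanC E x}
    (hs : SmoothGenC s) (ht : SmoothGenC t) (hsm : ∀ x, s x ∈ J.E01 x) (htm : ∀ x, t x ∈ J.E01 x)
    (hum : ∀ x, u x ∈ J.E01 x) (x : M) : pairingC E x (dorfmanC s t x) (u x) = 0 := by
  have h1 := J.isIsotropic_L.dorfmanC_mem hJ hs.conj ht.conj
    (fun y => Submodule.mem_sup_right (J.conj_mem_E10 (hsm y)))
    (fun y => Submodule.mem_sup_right (J.conj_mem_E10 (htm y))) x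
  have h2 := J.isIsotropic_L x _ h1 _ (Submodule.mem_sup_right (J.conj_mem_E10 (hum x)))
  rw [dorfmanC_conj hs ht, pairingC, Cplx.extendBilin_conj, map_eq_zero] at h2
  exact h2

/-- `L*` is its own orthogonal complement, so it is involutive if `⟨s ∘ t, u⟩ = 0` for all its
sections. The components of `s`, `t`, `u` along `η` contribute values of `dη` of type `(0,2)`, and
the components in `E01` contribute nothing by `pairingC_dorfmanC_E01`. -/
theorem isCourantClosed_Lstar (hJ : J.IsGeneralizedContact) (h : J.IsTypeOneOne) :
    IsCourantClosed J.Lstar := by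
  have hI := J.isIsotropic_Lstar
  let Γ (s : (x : M) → GenTanC E x) : Prop := SmoothGenC s ∧ ∀ x, s x ∈ J.Lstar x
  let p (s : (x : M) → GenTanC E x) (x : M) : GenTanC E x := J.projE Complex.I x (s x)
  have hp (s) (hs : Γ s) : SmoothGenC (p s) ∧ ∀ x, p s x ∈ J.E01 x :=
    ⟨J.smoothEnd_projE _ s hs.1, fun x => J.projE_mem_E01 x _⟩
  have hpΓ (s) (hs : Γ s) : Γ (p s) :=
    ⟨(hp s hs).1, fun x => Submodule.mem_sup_right ((hp s hs).2 x)⟩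
  have hη : Γ J.etaC := ⟨J.smoothGenC_etaC, J.etaC_mem⟩
  -- The component of a section of `L*` along `η` can be dropped in any argument of `⟨s ∘ t, u⟩`.
  have cyc (s t u) (hs : Γ s) (ht : Γ t) (hu : Γ u) (x : M) :
      pairingC E x (dorfmanC s t x) (u x) = pairingC E x (dorfmanC u s x) (t x) :=
    pairingC_dorfmanC_cyclic hs.1 ht.1 hu.1 (fun y => hI y _ (ht.2 y) _ (hu.2 y))
      (fun y => hI y _ (hu.2 y) _ (hs.2 y)) x
  have red (s t u) (hs : Γ s) (ht : Γ t) (hu : Γ u) (x : M) :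
      pairingC E x (dorfmanC s t x) (u x) = pairingC E x (dorfmanC s t x) (p u x) := by
    obtain ⟨c, hc⟩ := J.extend_projEta x (u x)
    have h1 := J.pullbackDEta_eq_zero h (hs.2 x) (ht.2 x)
    rw [pullbackDEta_eq, ← cyc s t _ hs ht hη, mul_eq_zero] at h1
    have h2 := J.isSplitting.symm.left_eq (hu.2 x)
    rw [projLstar, LinearMap.add_apply, hc] at h2
    nth_rw 1 [← h2]
    rw [map_add, map_smul, h1.resolve_left (by norm_num), smul_zero, zero_add]
  have zero (s t u) (hs : Γ s) (ht : Γ t) (hu : Γ u) (x : M) :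
      pairingC E x (dorfmanC s t x) (u x) = 0 := by
    rw [red s t u hs ht hu, cyc s t _ hs ht (hpΓ u hu), red _ s t (hpΓ u hu) hs ht,
      cyc _ s _ (hpΓ u hu) hs (hpΓ t ht), red _ _ s (hpΓ t ht) (hpΓ u hu) hs]
    exact J.pairingC_dorfmanC_E01 hJ (hp t ht).1 (hp u hu).1 (hp t ht).2 (hp u hu).2 (hp s hs).2 x
  intro s hs t ht
  rw [hI.courantC_eq hs ht]
  refine ⟨SmoothGenC.dorfmanC hs ht, fun x => J.isSplitting.symm.mem_of_orthogonal fun w hw => ?_⟩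
  obtain ⟨u, hu, rfl⟩ := exists_smoothGenC w
  have h1 := zero _ _ _ ⟨hs, fun x => (s x).2⟩ ⟨ht, fun x => (t x).2⟩
    ⟨J.isSplitting.smooth_right u hu, fun x => J.isSplitting.mem_right x (u x)⟩ x
  rwa [J.isSplitting.symm.left_eq hw] at h1

end AlmostContact
end GenContact

end

theorem mainTheorem1
    {E : Type*} [NormedAddCommGroup E] [NormedSpace ℝ E] [FiniteDimensional ℝ E]
    {M : Type*} [TopologicalSpace M] [T2Space M] [SecondCountableTopology M]
    [ChartedSpace E M] [IsManifold 𝓘(ℝ, E) ∞ M]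
    (hodd : Odd (Module.finrank ℝ E))
    (J : GenContact.AlmostContact E M) (hJ : J.IsGeneralizedContact) :
    GenContact.FormLieBialgebroid J.L J.Lstar ↔ J.IsTypeOneOne := by
  have hS := J.isSplitting
  constructor
  · rintro ⟨-, -, -, ℬ, -, hℬ, -⟩
    refine J.isTypeOneOne_of_isCourantClosed fun s hs t ht => ?_
    have h := funext (hℬ.2 s hs t ht)
    rw [← h]
    exact ⟨ℬ.bracket_mem s hs t ht, fun x => (ℬ.bracket s t x).2⟩
  · intro h
    obtain ⟨𝒜, h𝒜⟩ := GenContact.exists_isInduced hS.isotropic_left hS.isSubbundle hJ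
    obtain ⟨ℬ, hℬ⟩ := GenContact.exists_isInduced hS.isotropic_right hS.symm.isSubbundle
      (J.isCourantClosed_Lstar hJ h)
    exact ⟨hS.isSubbundle, hS.symm.isSubbundle, 𝒜, ℬ, h𝒜, hℬ, hS.isLieBialgebroid h𝒜 hℬ⟩
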